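/- **Setting.** A *relational metric structure* over a set of predicate symbols with arities is a complete metric space $(A,d)$ with a uniformly continuous map $R^{A}\colon A^{n}\to\mathbb R$ for each $n$-ary symbol $R$; $d$ counts as a distinguished binary predicate. *Embeddings* preserve the values of all predicates; *isomorphisms* are surjective embeddings. For a class $\mathcal K$ of finite structures, a *$\mathcal K$-structure* is a structure all of whose finite substructures lie in $\mathcal K$, and $\mathcal K_n$ is the set of $n$-tuples of points of members of $\mathcal K$. An embedding of such a tuple into a structure is a map of its entries that preserves all predicate values on them. For $\bar a,\bar b\in\mathcal K_n$, $d_{\mathcal K}(\bar a,\bar b)$ is the infimum of $\max_i d(a_i',b_i')$ over all pairs of embeddings $\bar a\mapsto\bar a'$, $\bar b\mapsto\bar b'$ into a common member of $\mathcal K$, and $d_\infty(\bar a,\bar b)$ is the supremum of $|R(\bar a_X)-R(\bar b_X)|$ over all $X\subseteq\{1,\dots,n\}$ and all predicates $R$ (including $d$) of arity $|X|$. The class $\mathcal K$ has * HP if every member of $\mathcal K$ is a $\mathcal K$-structure; * JEP if any two members embed into a third; * AP if for all embeddings $f_B\colon A\to B$, $f_C\colon A\to C$ between members there are $D\in\mathcal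 K$ and embeddings $g_B\colon B\to D$, $g_C\colon C\to D$ with $g_Bf_B=g_Cf_C$; * bAP if there are constants $c(n)$ such that any $(\bar a,w),(\bar a,z)\in\mathcal K_n$ with the same $\bar a$ have an amalgamation $(\bar a,w,z)\in\mathcal K_{n+1}$ with $d(w,z)\le c(n)\,d_\infty((\bar a,w),(\bar a,z))$; * PP if $(\mathcal K_n,d_{\mathcal K})$ is separable and complete for every $n$; * CP if every $n$-ary predicate is continuous on $(\mathcal K_n,d_{\mathcal K})$. $\mathcal K$ is a *Fraïssé class* if it has HP, JEP, AP, PP and CP. A *limit* of it is a separable $\mathcal K$-structure $M$ such that for every $B\in\mathcal K$ and every finite tuple $\bar a$ in $B$, each embedding of $\bar a$ into $M$ extends to an embedding of $B$ into $M$. $M$ is *ultrahomogeneous* if every embedding of a finite subset of $M$ into $M$ extends to an automorphism of $M$. A *diversity* is a set $X$ with a function $\delta$ from the finite subsets of $X$ to $[0,\infty)$ such that $\delta(A)=0$ if and only if $|A|\le 1$, and $\delta(A\cup C)\le\delta(A\cup B)+\delta(B\cup C)$ whenever $B\ne\emptyset$. Its induced metric is $d(x,y)=\delta(\{x,y\})$;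 completeness and separability refer to it. Embeddings of diversities preserve $\delta$. A complete diversity is a relational metric structure with metric $d$ and, for each $k\ge1$, the $k$-ary predicate $\delta_k(x_1,\dots,x_k)=\delta(\{x_1,\dots,x_k\})$. An *$L_1$ diversity* is one that embeds, for some measure space $(\Omega,\mathcal A,\mu)$, into $L_1(\Omega,\mathcal A,\mu)$ with $\delta(F)=\int_\Omega\bigl(\max_{f\in F}f-\min_{f\in F}f\bigr)\,d\mu$ for nonempty finite $F$ and $\delta(\emptyset)=0$. **Theorem.** The class $\mathcal K$ of finite $L_1$ diversities, viewed as relational metric structures, satisfies HP, JEP, bAP, PP and CP; in bAP one can take $c(n)=2^{2n}$. It is therefore a Fraïssé class. It has a limit $U$ that is a complete separable ultrahomogeneous $L_1$ diversity and is universal for separable $L_1$ diversities: every separable $L_1$ diversity embeds into $U$. It is unique: every complete separable ultrahomogeneous $L_1$ diversity that is universal for separable $L_1$ diversities is isomorphic to $U$, and so is every limit of $\mathcal K$. -/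

import Mathlib

open MeasureTheory
open scoped ENNReal NNReal

universe u

/-! ## Relational metric structures -/

/-- A relational signature: predicate symbols with arities.  The metric is a further,
distinguished binary predicate symbol, present in every signature and not listed in `Symb`. -/
structure RelSignature where
  Symb : Type
  arity : Symb → ℕ

/-- A relational metric structure: a complete metric space with a uniformly continuous
real-valued interpretation of every predicate symbol. -/
structure RelStruct (L : RelSignature) where
  carrier : Type u
  [metric : MetricSpace carrier]
  [complete : CompleteSpace carrier]
  interp : ∀ R : L.Symb, (Fin (L.arity R) → carrier) → ℝ
  uniformContinuous_interp : ∀ R : L.Symb, UniformContinuous (interp R)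

attribute [instance] RelStruct.metric RelStruct.complete

namespace RelStruct

variable {L : RelSignature}

/-- Embeddings preserve the value of every predicate, the metric included. -/
def IsEmbedding (A B : RelStruct.{u} L) (f : A.carrier → B.carrier) : Prop :=
  (∀ x y, dist (f x) (f y) = dist x y) ∧
    ∀ (R : L.Symb) (a : Fin (L.arity R) → A.carrier), B.interp R (f ∘ a) = A.interp R a

/-- An isomorphism is a surjective embedding. -/
def IsIsomorphism (A B : RelStruct.{u} L) (f : A.carrier → B.carrier) : Prop :=
  IsEmbedding A B f ∧ Function.Surjective f

/-- Every finite partial isomorphism of `M` extends to an automorphism of `M`. -/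
def Ultrahomogeneous (M : RelStruct.{u} L) : Prop :=
  ∀ (s : Set M.carrier), s.Finite → ∀ φ : s → M.carrier,
    (∀ x y : s, dist (φ x) (φ y) = dist (x : M.carrier) y) →
    (∀ (R : L.Symb) (a : Fin (L.arity R) → s),
      M.interp R (φ ∘ a) = M.interp R (fun i => (a i : M.carrier))) →
    ∃ f : M.carrier → M.carrier, IsIsomorphism M M f ∧ ∀ x : s, f x = φ x

/-- The map `a i ↦ b i` is an embedding of the tuple `a` (an enumerated structure) into `B`,
that is, it preserves the values of all predicates on the entries of `a`. -/
def TupleEmbeds {A B : RelStruct.{u} L} {n : ℕ}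
    (a : Fin n → A.carrier) (b : Fin n → B.carrier) : Prop :=
  (∀ i j, dist (b i) (b j) = dist (a i) (a j)) ∧
    ∀ (R : L.Symb) (e : Fin (L.arity R) → Fin n), B.interp R (b ∘ e) = A.interp R (a ∘ e)

/-- The distance `d_∞`: the largest difference between the values of a predicate (the metric
included) at corresponding subtuples; a subset of the index set `Fin n` of size `m` is given by
its increasing enumeration `Fin m ↪o Fin n`. -/
noncomputable def dInfty {A B : RelStruct.{u} L} {n : ℕ}
    (a : Fin n → A.carrier) (b : Fin n → B.carrier) : ℝ≥0∞ :=
  max (⨆ e : Fin 2 ↪o Fin n, edist (dist (a (e 0)) (a (e 1))) (dist (b (e 0)) (b (e 1))))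
    (⨆ (R : L.Symb) (e : Fin (L.arity R) ↪o Fin n),
      edist (A.interp R (a ∘ e)) (B.interp R (b ∘ e)))

end RelStruct

/-! ## Fraïssé classes -/

/-- A class of structures. -/
abbrev StructClass (L : RelSignature) := RelStruct.{u} L → Prop

namespace StructClass

variable {L : RelSignature}

/-- A `K`-structure: all its finite substructures are in `K`. -/
def IsKStructure (K : StructClass.{u} L) (A : RelStruct.{u} L) : Prop :=
  ∀ B : RelStruct.{u} L, Finite B.carrier → (∃ f, RelStruct.IsEmbedding B A f) → K B

/-- Hereditary Property. -/
def HP (K : StructClass.{u} L) : Prop := ∀ A, K A → K.IsKStructure A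

/-- Joint Embedding Property. -/
def JEP (K : StructClass.{u} L) : Prop :=
  ∀ A B, K A → K B →
    ∃ C, K C ∧ (∃ f, RelStruct.IsEmbedding A C f) ∧ ∃ g, RelStruct.IsEmbedding B C g

/-- Amalgamation Property. -/
def AP (K : StructClass.{u} L) : Prop :=
  ∀ (A B C : RelStruct.{u} L) (fB : A.carrier → B.carrier) (fC : A.carrier → C.carrier),
    K A → K B → K C → RelStruct.IsEmbedding A B fB → RelStruct.IsEmbedding A C fC →
    ∃ (D : RelStruct.{u} L) (gB : B.carrier → D.carrier) (gC : C.carrier → D.carrier),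
      K D ∧ RelStruct.IsEmbedding B D gB ∧ RelStruct.IsEmbedding C D gC ∧ gB ∘ fB = gC ∘ fC

/-- Bounded amalgamation with the constant `c n` for enumerated structures `(a, w)`, `(b, z)`
of length `n` (here written `n + 1`) whose common part `a`, `b` is the same. -/
def BAPWith (K : StructClass.{u} L) (c : ℕ → ℝ≥0) : Prop :=
  ∀ (n : ℕ) (A B : RelStruct.{u} L), K A → K B →
    ∀ (a : Fin n → A.carrier) (w : A.carrier) (b : Fin n → B.carrier) (z : B.carrier),
      RelStruct.TupleEmbeds (A := A) (B := B) a b →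
      ∃ (C : RelStruct.{u} L) (a' : Fin n → C.carrier) (w' z' : C.carrier), K C ∧
        RelStruct.TupleEmbeds (A := A) (B := C) (Fin.snoc a w : Fin (n + 1) → A.carrier)
          (Fin.snoc a' w' : Fin (n + 1) → C.carrier) ∧
        RelStruct.TupleEmbeds (A := B) (B := C) (Fin.snoc b z : Fin (n + 1) → B.carrier)
          (Fin.snoc a' z' : Fin (n + 1) → C.carrier) ∧
        edist w' z' ≤ (c (n + 1) : ℝ≥0∞) *
          RelStruct.dInfty (A := A) (B := B) (Fin.snoc a w : Fin (n + 1) → A.carrier)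
            (Fin.snoc b z : Fin (n + 1) → B.carrier)

/-- The bounded Amalgamation Property, with a constant that depends only on the length. -/
def BAP (K : StructClass.{u} L) : Prop := ∃ c : ℕ → ℝ≥0, K.BAPWith c

/-- The enumerated structures of length `n`: `n`-tuples of points of members of `K`. -/
structure Enum (K : StructClass.{u} L) (n : ℕ) where
  str : RelStruct.{u} L
  mem : K str
  tup : Fin n → str.carrier

/-- The distance `d_K` on enumerated structures: the infimum, over all joint embeddings of the
two tuples into a member of `K`, of the largest distance between corresponding entries. -/
noncomputable def dK (K : StructClass.{u} L) {n : ℕ} (x y : K.Enum n) : ℝ≥0∞ :=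
  ⨅ (C : RelStruct.{u} L) (_ : K C) (a : Fin n → C.carrier) (b : Fin n → C.carrier)
    (_ : RelStruct.TupleEmbeds (A := x.str) (B := C) x.tup a)
    (_ : RelStruct.TupleEmbeds (A := y.str) (B := C) y.tup b), ⨆ i, edist (a i) (b i)

/-- Polish Property: `d_K` is separable and complete on enumerated structures of each length. -/
def PP (K : StructClass.{u} L) : Prop :=
  ∀ n : ℕ,
    (∃ s : Set (K.Enum n), s.Countable ∧ ∀ x, ∀ ε > 0, ∃ y ∈ s, K.dK x y < ε) ∧
    ∀ x : ℕ → K.Enum n, (∀ ε > 0, ∃ N, ∀ i ≥ N, ∀ j ≥ N, K.dK (x i) (x j) < ε) →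
      ∃ y, ∀ ε > 0, ∃ N, ∀ i ≥ N, K.dK (x i) y < ε

/-- Continuity of a real function on enumerated structures with respect to `d_K`. -/
def ContinuousEnum (K : StructClass.{u} L) {n : ℕ} (F : K.Enum n → ℝ) : Prop :=
  ∀ x, ∀ ε > 0, ∃ η > 0, ∀ y, K.dK x y < η → |F x - F y| < ε

/-- Continuity Property: every predicate (the metric included) is continuous. -/
def CP (K : StructClass.{u} L) : Prop :=
  K.ContinuousEnum (n := 2) (fun x => dist (x.tup 0) (x.tup 1)) ∧
    ∀ R : L.Symb, K.ContinuousEnum (n := L.arity R) (fun x => x.str.interp R x.tup)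

/-- Fraïssé classes of finite structures. -/
structure IsFraisseClass (K : StructClass.{u} L) : Prop where
  finite : ∀ A, K A → Finite A.carrier
  hp : K.HP
  jep : K.JEP
  ap : K.AP
  pp : K.PP
  cp : K.CP

/-- An exact limit of `K`: a separable `K`-structure with the exact extension property. -/
structure IsExactLimit (K : StructClass.{u} L) (M : RelStruct.{u} L) : Prop where
  separable : TopologicalSpace.SeparableSpace M.carrier
  isKStructure : K.IsKStructure M
  extension : ∀ B : RelStruct.{u} L, K B → ∀ (n : ℕ) (a : Fin n → B.carrier)
    (h : Fin n → M.carrier), RelStruct.TupleEmbeds (A := B) (B := M) a h →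
      ∃ f, RelStruct.IsEmbedding B M f ∧ ∀ i, f (a i) = h i

end StructClass

/-! ## Diversities -/

open Classical in
/-- A diversity on `X`. -/
structure Diversity (X : Type u) where
  δ : Finset X → ℝ
  nonneg : ∀ A, 0 ≤ δ A
  eq_zero_iff : ∀ A, δ A = 0 ↔ A.card ≤ 1
  triangle : ∀ A B C, B.Nonempty → δ (A ∪ C) ≤ δ (A ∪ B) + δ (B ∪ C)

namespace Diversity

open Classical in
/-- The induced metric `d(x, y) = δ {x, y}`. -/
@[reducible] noncomputable def metricSpace {X : Type u} (D : Diversity X) : MetricSpace X where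
  dist x y := D.δ {x, y}
  dist_self x := by
    show D.δ {x, x} = 0
    rw [D.eq_zero_iff]; simp
  dist_comm x y := by
    show D.δ {x, y} = D.δ {y, x}
    rw [Finset.pair_comm]
  dist_triangle x y z := by
    have h := D.triangle {x} {y} {z} (Finset.singleton_nonempty y)
    exact h
  eq_of_dist_eq_zero := by
    intro x y h
    by_contra hne
    have h2 : Finset.card ({x, y} : Finset X) ≤ 1 := (D.eq_zero_iff _).1 h
    rw [Finset.card_pair hne] at h2
    omega

/-- A diversity is complete if its induced metric space is. -/
def IsComplete {X : Type u} (D : Diversity X) : Prop :=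
  @CompleteSpace X D.metricSpace.toUniformSpace

/-- A diversity is separable if its induced metric space is. -/
def IsSeparable {X : Type u} (D : Diversity X) : Prop :=
  @TopologicalSpace.SeparableSpace X D.metricSpace.toUniformSpace.toTopologicalSpace

open Classical in
/-- Embeddings of diversities. -/
def IsEmbedding {X Y : Type u} (D : Diversity X) (E : Diversity Y) (f : X → Y) : Prop :=
  ∀ A : Finset X, E.δ (A.image f) = D.δ A

open Classical in
/-- The function that a diversity induces on tuples: its value at the set of entries. -/
noncomputable def onTuple {X : Type u} (D : Diversity X) {n : ℕ} (a : Fin n → X) : ℝ :=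
  D.δ (Finset.univ.image a)

open Classical in
theorem replace_le {X : Type u} (D : Diversity X) {n : ℕ} (a b : Fin n → X)
    (s : Finset (Fin n)) : ∀ T : Finset X,
      D.δ (T ∪ s.image a) ≤ D.δ (T ∪ s.image b) + ∑ i ∈ s, D.δ {a i, b i} := by
  induction s using Finset.induction_on with
  | empty => intro T; simp
  | insert i s hi ih =>
    intro T
    have h1 := ih (insert (a i) T)
    have h2 := D.triangle (T ∪ s.image b) {b i} {a i} (Finset.singleton_nonempty _)
    have e1 : T ∪ (insert i s).image a = insert (a i) T ∪ s.image a := by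
      ext x; simp
    have e2 : T ∪ s.image b ∪ {a i} = insert (a i) T ∪ s.image b := by
      ext x; simp
    have e3 : T ∪ s.image b ∪ {b i} = T ∪ (insert i s).image b := by
      ext x; simp
    have e4 : ({b i} : Finset X) ∪ {a i} = {a i, b i} := by
      ext x; simp; tauto
    rw [e2, e3, e4] at h2
    rw [e1, Finset.sum_insert hi]
    linarith

open Classical in
theorem onTuple_sub_le {X : Type u} (D : Diversity X) {n : ℕ} (a b : Fin n → X) :
    letI := D.metricSpace
    D.onTuple a - D.onTuple b ≤ n * dist a b := by
  let _ := D.metricSpace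
  have h := D.replace_le a b Finset.univ ∅
  rw [Finset.empty_union, Finset.empty_union] at h
  have h3 : ∑ i : Fin n, D.δ {a i, b i} ≤ ∑ _i : Fin n, dist a b :=
    Finset.sum_le_sum fun i _ => dist_le_pi_dist a b i
  simp only [Finset.sum_const, Finset.card_univ, Fintype.card_fin, nsmul_eq_mul] at h3
  unfold onTuple
  linarith

theorem uniformContinuous_onTuple {X : Type u} (D : Diversity X) (n : ℕ) :
    letI := D.metricSpace
    UniformContinuous (fun a : Fin n → X => D.onTuple a) := by
  let _ := D.metricSpace
  refine (LipschitzWith.of_dist_le_mul (K := (n : ℝ≥0)) fun a b => ?_).uniformContinuous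
  have h1 := D.onTuple_sub_le a b
  have h2 := D.onTuple_sub_le b a
  rw [dist_comm] at h2
  rw [Real.dist_eq, abs_sub_le_iff]
  exact ⟨by simpa using h1, by simpa using h2⟩

/-- The signature of diversities: one predicate symbol of each arity `k + 1`, `k = 0, 1, …`. -/
def signature : RelSignature where
  Symb := ℕ
  arity k := k + 1

/-- A complete diversity as a relational metric structure: the metric is the induced metric and
the predicate of arity `k + 1` is the diversity function of the set of entries of a tuple. -/
noncomputable def toStruct {X : Type u} (D : Diversity X) (hD : D.IsComplete) :
    RelStruct.{u} signature :=
  letI := D.metricSpace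
  { carrier := X
    metric := D.metricSpace
    complete := hD
    interp := fun _ a => D.onTuple a
    uniformContinuous_interp := fun k => D.uniformContinuous_onTuple (signature.arity k) }

/-- `A` is the diversity `D` viewed as a relational metric structure. -/
def IsStructureOf (A : RelStruct.{u} signature) (D : Diversity A.carrier) : Prop :=
  (∀ x y : A.carrier, dist x y = D.onTuple ![x, y]) ∧
    ∀ (k : signature.Symb) (a : Fin (signature.arity k) → A.carrier), A.interp k a = D.onTuple a

/-! ## `L₁` diversities -/

/-- The diversity function on `L₁(Ω, μ)`: the integral of `max_{f ∈ F} f - min_{f ∈ F} f`. -/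
noncomputable def l1δ {Ω : Type u} [MeasurableSpace Ω] (μ : Measure Ω)
    (F : Finset (Lp ℝ 1 μ)) : ℝ :=
  if h : F.Nonempty then
    ∫ ω, (F.sup' h (fun f => (f : Ω → ℝ) ω) - F.inf' h (fun f => (f : Ω → ℝ) ω)) ∂μ
  else 0

open Classical in
/-- `L₁` diversities: those that embed into `L₁(Ω, μ)` for some measure space. -/
def IsL1 {X : Type u} (D : Diversity X) : Prop :=
  ∃ (Ω : Type u) (_ : MeasurableSpace Ω) (μ : Measure Ω) (φ : X → Lp ℝ 1 μ),
    ∀ A : Finset X, l1δ μ (A.image φ) = D.δ A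

/-- The class of finite `L₁` diversities, viewed as relational metric structures. -/
def finiteL1 : StructClass.{u} signature := fun A =>
  Finite A.carrier ∧ ∃ D : Diversity A.carrier, IsStructureOf A D ∧ D.IsL1

/-- `D` is universal for separable `L₁` diversities. -/
def IsL1Universal {X : Type u} (D : Diversity X) : Prop :=
  ∀ (Y : Type u) (E : Diversity Y), E.IsL1 → E.IsSeparable → ∃ f : Y → X, IsEmbedding E D f

end Diversity

/-! The limit is concrete: its points are the indicator functions, in `L₁`, of the subsets of finite
Lebesgue measure of a line.

Every finite `L₁` diversity is a nonnegative combination of cut functions: the difference of maximum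
and minimum of `f` is the integral over `t` of the cut functions of the superlevel sets `{t < f}`,
and integrating over the measure space keeps the combination nonnegative. On all finite subsets, not
only on pairs, the cut functions of distinct nontrivial cuts are linearly independent, and Möbius
inversion reads off the weight of each cut as a fixed linear functional (`coeff_cut`). A diversity
in this cone is thus the same thing as its weights. For a family of sets of finite measure, the
weight of a cut is the measure of an atom of the family (`coeff_setδ`).

Deleting a point `j` merges the cuts `S` and `S ∪ {j}` and adds their weights
(`coeff_add_coeff_insert`). To realize a prescribed one-point extension by a new set, it is
therefore enough to choose in each atom of the given sets a piece of prescribed measure. It fits,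
because the atom has the sum of two prescribed weights as its measure, or infinite measure for the
trivial cut (`exists_update_setδ`). This yields the forth property and hence a limit. JEP, AP, PP,
universality and ultrahomogeneity are then formal consequences of having a limit, and uniqueness is
back and forth; HP and CP are direct.

For bAP one starts from a set already in place. The new pieces can be nested with the old ones, so
that the set moves by at most the sum of the changes of weights. Each weight is an alternating sum
of at most `2 ^ n` values and there are at most `2 ^ n` atoms, whence `2 ^ (2 * n)`. -/

theorem exists_monotone_chain {α : Type*} {P : Set α → Prop} {Q : ℕ → Set α → Prop}
    (step : ∀ n S, P S → ∃ S', S ⊆ S' ∧ P S' ∧ Q n S') {S₀ : Set α} (h₀ : P S₀) :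
    ∃ s : ℕ → Set α, s 0 = S₀ ∧ Monotone s ∧ ∀ n, P (s n) ∧ Q n (s (n + 1)) := by
  choose! next h1 h2 h3 using step
  let s : ℕ → Set α := fun n => Nat.rec S₀ (fun k S => next k S) n
  have hP : ∀ n, P (s n) := by
    intro n
    induction n with
    | zero => exact h₀
    | succ k ih => exact h2 k _ ih
  exact ⟨s, rfl, monotone_nat_of_le_succ fun n => h1 n _ (hP n), fun n => ⟨hP n, h3 n _ (hP n)⟩⟩

/-! ### Partial isomorphisms and back and forth -/

namespace RelStruct

variable {L : RelSignature}

/-- A set of pairs along which all predicates, the metric included, take the same values. -/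
def IsPartialIso (A B : RelStruct.{u} L) (S : Set (A.carrier × B.carrier)) : Prop :=
  (∀ p ∈ S, ∀ q ∈ S, dist p.2 q.2 = dist p.1 q.1) ∧
    ∀ (R : L.Symb) (e : Fin (L.arity R) → A.carrier × B.carrier), (∀ i, e i ∈ S) →
      B.interp R (fun i => (e i).2) = A.interp R (fun i => (e i).1)

/-- Every finite partial isomorphism from `A` to `B` extends to any further point of `A`. -/
def HasForth (A B : RelStruct.{u} L) : Prop :=
  ∀ S : Set (A.carrier × B.carrier), S.Finite → IsPartialIso A B S → ∀ x,
    ∃ y, IsPartialIso A B (insert (x, y) S)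

variable {A B C : RelStruct.{u} L}

namespace IsPartialIso

theorem mono {S T : Set (A.carrier × B.carrier)} (hT : IsPartialIso A B T) (h : S ⊆ T) :
    IsPartialIso A B S :=
  ⟨fun p hp q hq => hT.1 p (h hp) q (h hq), fun R e he => hT.2 R e fun i => h (he i)⟩

theorem swap {S : Set (A.carrier × B.carrier)} (hS : IsPartialIso A B S) :
    IsPartialIso B A (Prod.swap ⁻¹' S) :=
  ⟨fun p hp q hq => (hS.1 p.swap hp q.swap hq).symm,
    fun R e he => (hS.2 R (fun i => (e i).swap) he).symm⟩

/-- A nullary predicate would be compared even on no points at all, which is why arity zero is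
excluded. -/
theorem empty (hL : ∀ R, L.arity R ≠ 0) : IsPartialIso A B ∅ :=
  ⟨fun _ hp => hp.elim, fun R _ he => (he ⟨0, Nat.pos_of_ne_zero (hL R)⟩).elim⟩

theorem iUnion {s : ℕ → Set (A.carrier × B.carrier)} (hs : Monotone s)
    (h : ∀ n, IsPartialIso A B (s n)) : IsPartialIso A B (⋃ n, s n) := by
  constructor
  · intro p hp q hq
    obtain ⟨i, hi⟩ := Set.mem_iUnion.1 hp
    obtain ⟨j, hj⟩ := Set.mem_iUnion.1 hq
    exact (h (max i j)).1 p (hs (le_max_left i j) hi) q (hs (le_max_right i j) hj)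
  · intro R e he
    choose k hk using fun i => Set.mem_iUnion.1 (he i)
    exact (h (Finset.univ.sup k)).2 R e fun i => hs (Finset.le_sup (Finset.mem_univ i)) (hk i)

/-- Predicates are continuous, so the equalities of values pass to limits of pairs and of tuples of
pairs. -/
theorem closure {S : Set (A.carrier × B.carrier)} (hS : IsPartialIso A B S) :
    IsPartialIso A B (closure S) := by
  constructor
  · have h : Set.EqOn (fun z : (A.carrier × B.carrier) × (A.carrier × B.carrier) =>
        dist z.1.2 z.2.2) (fun z => dist z.1.1 z.2.1) (_root_.closure (S ×ˢ S)) :=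
      Set.EqOn.closure (fun z hz => hS.1 _ hz.1 _ hz.2) (by fun_prop) (by fun_prop)
    intro p hp q hq
    refine h (x := (p, q)) ?_
    rw [closure_prod_eq]
    exact ⟨hp, hq⟩
  · intro R
    have hA := (A.uniformContinuous_interp R).continuous
    have hB := (B.uniformContinuous_interp R).continuous
    have h : Set.EqOn (fun e : Fin (L.arity R) → A.carrier × B.carrier =>
        B.interp R (fun i => (e i).2)) (fun e => A.interp R (fun i => (e i).1))
        (_root_.closure (Set.univ.pi fun _ => S)) :=
      Set.EqOn.closure (fun e he => hS.2 R e fun i => he i trivial)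
        (hB.comp (by fun_prop)) (hA.comp (by fun_prop))
    intro e he
    refine h ?_
    rw [closure_pi_set]
    exact fun i _ => he i

theorem exists_mem_closure {S : Set (A.carrier × B.carrier)} (hS : IsPartialIso A B S)
    (hd : Dense (Prod.fst '' S)) (x : A.carrier) : ∃ y, (x, y) ∈ _root_.closure S := by
  obtain ⟨u, hu, hx⟩ := mem_closure_iff_seq_limit.1 (hd x)
  choose p hp hpu using hu
  have hpx : Filter.Tendsto (fun n => (p n).1) Filter.atTop (nhds x) := by simpa only [hpu] using hx
  have hc : CauchySeq fun n => (p n).2 := by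
    rw [Metric.cauchySeq_iff]
    intro ε hε
    obtain ⟨N, hN⟩ := Metric.cauchySeq_iff.1 hpx.cauchySeq ε hε
    exact ⟨N, fun m hm n hn => (hS.1 _ (hp m) _ (hp n)).trans_lt (hN m hm n hn)⟩
  obtain ⟨y, hy⟩ := cauchySeq_tendsto_of_complete hc
  exact ⟨y, mem_closure_iff_seq_limit.2 ⟨p, hp, hpx.prodMk_nhds hy⟩⟩

/-- The closure of `S` is the graph of the embedding: it covers all of `A` because `B` is complete,
and it is single-valued because distances are preserved. Applied to the swapped relation, the same
covering argument gives surjectivity. -/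
theorem exists_embedding {S : Set (A.carrier × B.carrier)} (hS : IsPartialIso A B S)
    (hd : Dense (Prod.fst '' S)) :
    ∃ f, IsEmbedding A B f ∧ (∀ p ∈ S, f p.1 = p.2) ∧
      (Dense (Prod.snd '' S) → Function.Surjective f) := by
  choose f hf using hS.exists_mem_closure hd
  have hT := hS.closure
  have huniq : ∀ p ∈ _root_.closure S, f p.1 = p.2 := fun p hp =>
    dist_eq_zero.1 ((hT.1 _ (hf p.1) _ hp).trans (dist_self _))
  refine ⟨f, ⟨fun x y => hT.1 _ (hf x) _ (hf y), fun R a => hT.2 R (fun i => (a i, f (a i)))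
    fun i => hf (a i)⟩, fun p hp => huniq p (subset_closure hp), fun hd' y => ?_⟩
  have hd2 : Dense (Prod.fst '' (Prod.swap ⁻¹' S : Set (B.carrier × A.carrier))) := by
    rw [← Set.image_swap_eq_preimage_swap, Set.image_image]
    exact hd'
  obtain ⟨x, hx⟩ := hS.swap.exists_mem_closure hd2 y
  refine ⟨x, huniq (x, y) ?_⟩
  have := (continuous_swap.closure_preimage_subset S) hx
  exact this

end IsPartialIso

theorem tupleEmbeds_iff {n : ℕ} {a : Fin n → A.carrier} {b : Fin n → B.carrier} :
    TupleEmbeds a b ↔ IsPartialIso A B (Set.range fun i => (a i, b i)) := by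
  constructor
  · rintro ⟨h1, h2⟩
    refine ⟨?_, fun R e he => ?_⟩
    · rintro _ ⟨i, rfl⟩ _ ⟨j, rfl⟩
      exact h1 i j
    · choose k hk using he
      obtain rfl : (fun i => (a (k i), b (k i))) = e := funext hk
      exact h2 R k
  · rintro ⟨h1, h2⟩
    exact ⟨fun i j => h1 _ ⟨i, rfl⟩ _ ⟨j, rfl⟩,
      fun R e => h2 R (fun i => (a (e i), b (e i))) fun i => ⟨e i, rfl⟩⟩

theorem TupleEmbeds.symm {n : ℕ} {a : Fin n → A.carrier} {b : Fin n → B.carrier}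
    (h : TupleEmbeds a b) : TupleEmbeds b a :=
  ⟨fun i j => (h.1 i j).symm, fun R e => (h.2 R e).symm⟩

theorem TupleEmbeds.trans {n : ℕ} {a : Fin n → A.carrier} {b : Fin n → B.carrier}
    {c : Fin n → C.carrier} (h : TupleEmbeds a b) (h' : TupleEmbeds b c) : TupleEmbeds a c :=
  ⟨fun i j => (h'.1 i j).trans (h.1 i j), fun R e => (h'.2 R e).trans (h.2 R e)⟩

theorem tupleEmbeds_of_isEmpty (hL : ∀ R, L.arity R ≠ 0) (a : Fin 0 → A.carrier)
    (b : Fin 0 → B.carrier) : TupleEmbeds a b :=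
  ⟨fun i => i.elim0, fun R e => (e ⟨0, Nat.pos_of_ne_zero (hL R)⟩).elim0⟩

theorem IsEmbedding.injective {f : A.carrier → B.carrier} (hf : IsEmbedding A B f) :
    Function.Injective f := fun x y hxy => by
  rw [← dist_eq_zero, ← hf.1, hxy, dist_self]

theorem IsEmbedding.tupleEmbeds {f : A.carrier → B.carrier} (hf : IsEmbedding A B f) {n : ℕ}
    (a : Fin n → A.carrier) : TupleEmbeds a (fun i => f (a i)) :=
  ⟨fun _ _ => hf.1 _ _, fun R e => hf.2 R (a ∘ e)⟩

theorem IsEmbedding.isPartialIso {f : A.carrier → B.carrier} (hf : IsEmbedding A B f)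
    {S : Set (A.carrier × B.carrier)} (hS : ∀ p ∈ S, p.2 = f p.1) : IsPartialIso A B S := by
  refine ⟨fun p hp q hq => ?_, fun R e he => ?_⟩
  · rw [hS p hp, hS q hq, hf.1]
  · rw [← hf.2 R]
    exact congrArg _ (funext fun i => hS _ (he i))

theorem IsEmbedding.comp {f : A.carrier → B.carrier} {g : B.carrier → C.carrier}
    (hg : IsEmbedding B C g) (hf : IsEmbedding A B f) : IsEmbedding A C (g ∘ f) :=
  ⟨fun x y => (hg.1 _ _).trans (hf.1 x y), fun R a => (hg.2 R (f ∘ a)).trans (hf.2 R a)⟩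

/-- The substructure on a finite set of points. -/
def restrict (A : RelStruct.{u} L) (s : Set A.carrier) (hs : s.Finite) : RelStruct.{u} L :=
  haveI : CompleteSpace s := hs.isCompact.isComplete.completeSpace_coe
  { carrier := s
    interp := fun R a => A.interp R fun i => (a i : A.carrier)
    uniformContinuous_interp := fun R => (A.uniformContinuous_interp R).comp <|
      uniformContinuous_pi.2 fun i =>
        uniformContinuous_subtype_val.comp (Pi.uniformContinuous_proj _ i) }

/-- The inclusion of a finite substructure. -/
def restrictVal (A : RelStruct.{u} L) (s : Set A.carrier) (hs : s.Finite) :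
    (A.restrict s hs).carrier → A.carrier := Subtype.val

/-- A point of a finite set as a point of the substructure on that set. -/
def restrictMk (A : RelStruct.{u} L) {s : Set A.carrier} (hs : s.Finite) {x : A.carrier}
    (hx : x ∈ s) : (A.restrict s hs).carrier := ⟨x, hx⟩

theorem finite_restrict (A : RelStruct.{u} L) {s : Set A.carrier} (hs : s.Finite) :
    Finite (A.restrict s hs).carrier := hs.to_subtype

theorem isEmbedding_restrictVal (A : RelStruct.{u} L) {s : Set A.carrier} (hs : s.Finite) :
    IsEmbedding (A.restrict s hs) A (A.restrictVal s hs) :=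
  ⟨fun _ _ => rfl, fun _ _ => rfl⟩

theorem IsEmbedding.codRestrict {f : A.carrier → B.carrier} (hf : IsEmbedding A B f)
    {s : Set B.carrier} (hs : s.Finite) (h : ∀ x, f x ∈ s) :
    IsEmbedding A (B.restrict s hs) (fun x => B.restrictMk hs (h x)) :=
  ⟨hf.1, hf.2⟩

theorem TupleEmbeds.codRestrict {n : ℕ} {a : Fin n → A.carrier} {b : Fin n → B.carrier}
    (hab : TupleEmbeds a b) {s : Set B.carrier} (hs : s.Finite) (h : ∀ i, b i ∈ s) :
    TupleEmbeds (A := A) (B := B.restrict s hs) a (fun i => B.restrictMk hs (h i)) :=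
  ⟨hab.1, hab.2⟩

/-- One-sided extension of a finite partial isomorphism to an embedding. -/
theorem HasForth.exists_embedding [TopologicalSpace.SeparableSpace A.carrier]
    (h : HasForth A B) {S : Set (A.carrier × B.carrier)} (hfin : S.Finite)
    (hS : IsPartialIso A B S) : ∃ f, IsEmbedding A B f ∧ ∀ p ∈ S, f p.1 = p.2 := by
  rcases isEmpty_or_nonempty A.carrier with hA | hA
  · obtain ⟨f, hf, hfS, -⟩ := hS.exists_embedding (fun x => hA.elim x)
    exact ⟨f, hf, hfS⟩
  obtain ⟨a, ha⟩ := TopologicalSpace.exists_dense_seq A.carrier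
  obtain ⟨s, hs0, hsm, hs⟩ := exists_monotone_chain
    (P := fun T : Set (A.carrier × B.carrier) => T.Finite ∧ IsPartialIso A B T)
    (Q := fun n T => a n ∈ Prod.fst '' T) (S₀ := S)
    (fun n T hT => by
      obtain ⟨y, hy⟩ := h T hT.1 hT.2 (a n)
      exact ⟨_, Set.subset_insert _ _, ⟨hT.1.insert _, hy⟩, ⟨(a n, y), Set.mem_insert _ _, rfl⟩⟩)
    ⟨hfin, hS⟩
  obtain ⟨f, hf, hfS, -⟩ := (IsPartialIso.iUnion hsm fun n => (hs n).1.2).exists_embedding <|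
    ha.mono (by
      rintro _ ⟨n, rfl⟩
      exact Set.image_mono (Set.subset_iUnion s (n + 1)) (hs n).2)
  exact ⟨f, hf, fun p hp => hfS p (Set.mem_iUnion.2 ⟨0, hs0 ▸ hp⟩)⟩

/-- Back and forth. -/
theorem HasForth.exists_isomorphism [TopologicalSpace.SeparableSpace A.carrier]
    [TopologicalSpace.SeparableSpace B.carrier] [Nonempty A.carrier] [Nonempty B.carrier]
    (h : HasForth A B) (h' : HasForth B A) {S : Set (A.carrier × B.carrier)} (hfin : S.Finite)
    (hS : IsPartialIso A B S) : ∃ f, IsIsomorphism A B f ∧ ∀ p ∈ S, f p.1 = p.2 := by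
  obtain ⟨a, ha⟩ := TopologicalSpace.exists_dense_seq A.carrier
  obtain ⟨b, hb⟩ := TopologicalSpace.exists_dense_seq B.carrier
  obtain ⟨s, hs0, hsm, hs⟩ := exists_monotone_chain
    (P := fun T : Set (A.carrier × B.carrier) => T.Finite ∧ IsPartialIso A B T)
    (Q := fun n T => a n ∈ Prod.fst '' T ∧ b n ∈ Prod.snd '' T) (S₀ := S)
    (fun n T hT => by
      obtain ⟨y, hy⟩ := h T hT.1 hT.2 (a n)
      have hfin1 : (insert (a n, y) T).Finite := hT.1.insert _
      obtain ⟨x, hx⟩ := h' _ (hfin1.preimage Prod.swap_injective.injOn) hy.swap (b n)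
      refine ⟨insert (x, b n) (insert (a n, y) T),
        (Set.subset_insert _ _).trans (Set.subset_insert _ _), ⟨hfin1.insert _, ?_⟩,
        ⟨(a n, y), Set.mem_insert_of_mem _ (Set.mem_insert _ _), rfl⟩,
        ⟨(x, b n), Set.mem_insert _ _, rfl⟩⟩
      refine hx.swap.mono ?_
      rintro p (rfl | hp)
      · exact Set.mem_insert _ _
      · exact Set.mem_insert_of_mem _ hp)
    ⟨hfin, hS⟩
  obtain ⟨f, hf, hfS, hsurj⟩ :=
    (IsPartialIso.iUnion hsm fun n => (hs n).1.2).exists_embedding <| ha.mono (by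
      rintro _ ⟨n, rfl⟩
      exact Set.image_mono (Set.subset_iUnion s (n + 1)) (hs n).2.1)
  refine ⟨f, ⟨hf, hsurj <| hb.mono ?_⟩, fun p hp => hfS p (Set.mem_iUnion.2 ⟨0, hs0 ▸ hp⟩)⟩
  rintro _ ⟨n, rfl⟩
  exact Set.image_mono (Set.subset_iUnion s (n + 1)) (hs n).2.2

end RelStruct

/-! ### Consequences and characterizations of limits -/

namespace StructClass

open RelStruct

variable {L : RelSignature} {K : StructClass.{u} L} {M N : RelStruct.{u} L}

theorem IsKStructure.restrict (hN : K.IsKStructure N) {s : Set N.carrier} (hs : s.Finite) :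
    K (N.restrict s hs) :=
  hN _ (N.finite_restrict hs) ⟨_, N.isEmbedding_restrictVal hs⟩

namespace IsExactLimit

/-- The domain of `S` together with `x` is a finite substructure of `N`, hence a member of `K`, and
the extension property of `M` applies to it. -/
theorem hasForth (hM : K.IsExactLimit M) (hN : K.IsKStructure N) : HasForth N M := by
  intro S hS hiso x
  have hfin : (insert x (Prod.fst '' S)).Finite := (hS.image _).insert _
  have : Finite S := hS
  obtain ⟨n, ⟨e⟩⟩ := Finite.exists_equiv_fin S
  have hmem : ∀ p ∈ S, p.1 ∈ insert x (Prod.fst '' S) := fun p hp =>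
    Set.mem_insert_of_mem _ ⟨p, hp, rfl⟩
  obtain ⟨f, hf, hfa⟩ := hM.extension (N.restrict _ hfin) (hN.restrict hfin) n
    (fun i => N.restrictMk hfin (hmem _ (e.symm i).2)) (fun i => (e.symm i : N.carrier × M.carrier).2)
    ⟨fun i j => hiso.1 _ (e.symm i).2 _ (e.symm j).2,
      fun R k => hiso.2 R (fun i => (e.symm (k i) : N.carrier × M.carrier)) fun i => (e.symm (k i)).2⟩
  refine ⟨f (N.restrictMk hfin (Set.mem_insert _ _)), ?_⟩
  have hval : ∀ p ∈ insert (x, f (N.restrictMk hfin (Set.mem_insert _ _))) S,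
      ∃ h : p.1 ∈ insert x (Prod.fst '' S), p.2 = f (N.restrictMk hfin h) := by
    rintro p (rfl | hp)
    · exact ⟨Set.mem_insert _ _, rfl⟩
    · refine ⟨hmem p hp, ?_⟩
      have := hfa (e ⟨p, hp⟩)
      simp only [Equiv.symm_apply_apply] at this
      exact this.symm
  refine ⟨fun p hp q hq => ?_, fun R k hk => ?_⟩
  · obtain ⟨h1, e1⟩ := hval p hp
    obtain ⟨h2, e2⟩ := hval q hq
    rw [e1, e2, hf.1]
    rfl
  · choose h1 e1 using fun i => hval _ (hk i)
    rw [funext e1]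
    exact hf.2 R fun i => N.restrictMk hfin (h1 i)

theorem exists_embedding (hL : ∀ R, L.arity R ≠ 0) (hM : K.IsExactLimit M)
    (hN : K.IsKStructure N) [TopologicalSpace.SeparableSpace N.carrier] :
    ∃ f, IsEmbedding N M f := by
  obtain ⟨f, hf, -⟩ := (hM.hasForth hN).exists_embedding Set.finite_empty (.empty hL)
  exact ⟨f, hf⟩

theorem nonempty (hL : ∀ R, L.arity R ≠ 0) (hM : K.IsExactLimit M) {B : RelStruct.{u} L}
    (hB : K B) (x : B.carrier) : Nonempty M.carrier := by
  obtain ⟨f, -⟩ := hM.extension B hB 0 Fin.elim0 Fin.elim0 (tupleEmbeds_of_isEmpty hL _ _)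
  exact ⟨f x⟩

theorem exists_isomorphism (hL : ∀ R, L.arity R ≠ 0) {B : RelStruct.{u} L} (hB : K B)
    (x : B.carrier) (hN : K.IsExactLimit N) (hM : K.IsExactLimit M) :
    ∃ f, IsIsomorphism N M f := by
  have := hM.separable
  have := hN.separable
  have := hM.nonempty hL hB x
  have := hN.nonempty hL hB x
  obtain ⟨f, hf, -⟩ := (hM.hasForth hN.isKStructure).exists_isomorphism
    (hN.hasForth hM.isKStructure) Set.finite_empty (.empty hL)
  exact ⟨f, hf⟩

theorem ultrahomogeneous [Nonempty M.carrier] (hM : K.IsExactLimit M) : M.Ultrahomogeneous := by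
  intro s hs φ hd hR
  have := hM.separable
  have : Finite s := hs
  obtain ⟨f, hf, hfS⟩ := (hM.hasForth hM.isKStructure).exists_isomorphism
    (hM.hasForth hM.isKStructure) (Set.finite_range fun x : s => ((x : M.carrier), φ x)) <| by
      refine ⟨?_, fun R e he => ?_⟩
      · rintro _ ⟨x, rfl⟩ _ ⟨y, rfl⟩
        exact hd x y
      · choose k hk using he
        obtain rfl : (fun i => ((k i : M.carrier), φ (k i))) = e := funext hk
        exact hR R k
  exact ⟨f, hf, fun x => hfS _ ⟨x, rfl⟩⟩

theorem exists_embedding_of_mem (hL : ∀ R, L.arity R ≠ 0) (hM : K.IsExactLimit M)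
    {B : RelStruct.{u} L} (hB : K B) : ∃ f, IsEmbedding B M f := by
  obtain ⟨f, hf, -⟩ := hM.extension B hB 0 Fin.elim0 Fin.elim0 (tupleEmbeds_of_isEmpty hL _ _)
  exact ⟨f, hf⟩

theorem jep (hL : ∀ R, L.arity R ≠ 0) (hK : ∀ A, K A → Finite A.carrier)
    (hM : K.IsExactLimit M) : K.JEP := by
  intro A B hA hB
  have := hK A hA
  have := hK B hB
  obtain ⟨f, hf⟩ := hM.exists_embedding_of_mem hL hA
  obtain ⟨g, hg⟩ := hM.exists_embedding_of_mem hL hB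
  have hfin : (Set.range f ∪ Set.range g).Finite := (Set.finite_range f).union (Set.finite_range g)
  exact ⟨M.restrict _ hfin, hM.isKStructure.restrict hfin,
    ⟨_, hf.codRestrict hfin fun x => .inl ⟨x, rfl⟩⟩,
    ⟨_, hg.codRestrict hfin fun x => .inr ⟨x, rfl⟩⟩⟩

/-- First `B` is placed in `M`, then `C` is placed over the image of `A` by the extension property;
the two images together span the amalgam. -/
theorem ap (hL : ∀ R, L.arity R ≠ 0) (hK : ∀ A, K A → Finite A.carrier)
    (hM : K.IsExactLimit M) : K.AP := by
  intro A B C fB fC hA hB hC hfB hfC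
  have := hK A hA
  have := hK B hB
  have := hK C hC
  obtain ⟨f, hf⟩ := hM.exists_embedding_of_mem hL hB
  obtain ⟨n, ⟨e⟩⟩ := Finite.exists_equiv_fin A.carrier
  obtain ⟨g, hg, hgC⟩ := hM.extension C hC n (fun i => fC (e.symm i))
    (fun i => f (fB (e.symm i)))
    ((hfC.tupleEmbeds e.symm).symm.trans ((hf.comp hfB).tupleEmbeds e.symm))
  have hfin : (Set.range f ∪ Set.range g).Finite := (Set.finite_range f).union (Set.finite_range g)
  refine ⟨M.restrict _ hfin, _, _, hM.isKStructure.restrict hfin,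
    hf.codRestrict hfin fun x => .inl ⟨x, rfl⟩, hg.codRestrict hfin fun x => .inr ⟨x, rfl⟩, ?_⟩
  funext x
  have := hgC (e x)
  rw [Equiv.symm_apply_apply] at this
  exact Subtype.ext this.symm

/-- A finite tuple of points of a limit as an enumerated structure. -/
def enum (hM : K.IsExactLimit M) {n : ℕ} (v : Fin n → M.carrier) : K.Enum n where
  str := M.restrict _ (Set.finite_range v)
  mem := hM.isKStructure.restrict _
  tup := fun i => M.restrictMk _ ⟨i, rfl⟩

theorem tupleEmbeds_enum (hM : K.IsExactLimit M) {n : ℕ} (v : Fin n → M.carrier) :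
    TupleEmbeds (A := (hM.enum v).str) (B := M) (hM.enum v).tup v :=
  ⟨fun _ _ => rfl, fun _ _ => rfl⟩

theorem dK_le (hM : K.IsExactLimit M) {n : ℕ} {x y : K.Enum n} {v w : Fin n → M.carrier}
    (hx : TupleEmbeds (A := x.str) (B := M) x.tup v)
    (hy : TupleEmbeds (A := y.str) (B := M) y.tup w) : K.dK x y ≤ edist v w := by
  have hfin : (Set.range v ∪ Set.range w).Finite := (Set.finite_range v).union (Set.finite_range w)
  refine (iInf₂_le (M.restrict _ hfin) (hM.isKStructure.restrict hfin)).trans <|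
    (iInf₂_le _ _).trans <|
    (iInf₂_le (hx.codRestrict hfin fun i => .inl ⟨i, rfl⟩)
      (hy.codRestrict hfin fun i => .inr ⟨i, rfl⟩)).trans <| iSup_le fun i => ?_
  exact edist_le_pi_edist v w i

/-- A nearly optimal joint embedding into some `C` moves into `M` by extending `a ↦ v` to all of
`C`, so a given realization of `x` need not be changed. Together with `dK_le` this reduces questions
about `d_K` to tuples of `M`. -/
theorem exists_tuple (hM : K.IsExactLimit M) {n : ℕ} {x y : K.Enum n} {ε : ℝ≥0∞}
    (h : K.dK x y < ε) {v : Fin n → M.carrier}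
    (hx : TupleEmbeds (A := x.str) (B := M) x.tup v) :
    ∃ w : Fin n → M.carrier, TupleEmbeds (A := y.str) (B := M) y.tup w ∧ edist v w < ε := by
  simp only [dK, iInf_lt_iff] at h
  obtain ⟨C, hC, a, b, hxa, hyb, hab⟩ := h
  obtain ⟨f, hf, hfa⟩ := hM.extension C hC n a v (hxa.symm.trans hx)
  refine ⟨fun i => f (b i), hyb.trans (hf.tupleEmbeds b), ?_⟩
  refine lt_of_le_of_lt ?_ hab
  refine edist_pi_le_iff.2 fun i => ?_
  refine le_trans (le_of_eq ?_) (le_iSup _ i)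
  rw [← hfa i, edist_dist, edist_dist, hf.1]

/-- Separability comes from a dense set of tuples of `M`. For completeness, a fast Cauchy
subsequence is realized in `M` one term at a time, each near the previous one, and the limit in `M`
is the limit for `d_K`. -/
theorem pp (hL : ∀ R, L.arity R ≠ 0) (hM : K.IsExactLimit M) : K.PP := by
  have hemb : ∀ {n : ℕ} (x : K.Enum n), ∃ v : Fin n → M.carrier,
      TupleEmbeds (A := x.str) (B := M) x.tup v := fun x => by
    obtain ⟨f, hf⟩ := hM.exists_embedding_of_mem hL x.mem
    exact ⟨_, hf.tupleEmbeds x.tup⟩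
  have := hM.separable
  intro n
  constructor
  · obtain ⟨t, htc, htd⟩ := TopologicalSpace.exists_countable_dense (Fin n → M.carrier)
    refine ⟨hM.enum '' t, htc.image _, fun x ε hε => ?_⟩
    obtain ⟨v, hv⟩ := hemb x
    obtain ⟨w, hw, hvw⟩ := EMetric.mem_closure_iff.1 (htd v) ε hε
    exact ⟨_, ⟨w, hw, rfl⟩, (hM.dK_le hv (hM.tupleEmbeds_enum w)).trans_lt hvw⟩
  · intro x hx
    have hpos : ∀ k : ℕ, (0 : ℝ≥0∞) < (2⁻¹ : ℝ≥0∞) ^ k := fun k => ENNReal.pow_pos (by simp) k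
    choose N hN using fun k : ℕ => hx _ (hpos k)
    -- The running maximum of the thresholds `N` makes the subsequence of indices monotone.
    let m : ℕ → ℕ := fun k => Nat.rec (N 0) (fun k r => max r (N (k + 1))) k
    have hmono : Monotone m := monotone_nat_of_le_succ fun k => le_max_left _ _
    have hmN : ∀ k, N k ≤ m k := by
      intro k
      cases k with
      | zero => exact le_rfl
      | succ k => exact le_max_right _ _
    have hstep : ∀ k (v : Fin n → M.carrier),
        TupleEmbeds (A := (x (m k)).str) (B := M) (x (m k)).tup v →
        ∃ w : Fin n → M.carrier,
          TupleEmbeds (A := (x (m (k + 1))).str) (B := M) (x (m (k + 1))).tup w ∧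
            edist v w < (2⁻¹ : ℝ≥0∞) ^ k := fun k v hv =>
      hM.exists_tuple
        (hN k _ (hmN k) _ ((hmN k).trans (hmono (Nat.le_succ k)))) hv
    choose! next hnext1 hnext2 using hstep
    obtain ⟨v0, hv0⟩ := hemb (x (m 0))
    let v : ℕ → Fin n → M.carrier := fun k => Nat.rec v0 (fun k w => next k w) k
    have hv : ∀ k, TupleEmbeds (A := (x (m k)).str) (B := M) (x (m k)).tup (v k) := by
      intro k
      induction k with
      | zero => exact hv0
      | succ k ih => exact hnext1 k _ ih
    have hd : ∀ k, edist (v k) (v (k + 1)) ≤ (2⁻¹ : ℝ≥0∞) ^ k := fun k => (hnext2 k _ (hv k)).le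
    have hc : CauchySeq v := by
      refine cauchySeq_of_edist_le_of_tsum_ne_top _ hd ?_
      rw [ENNReal.tsum_geometric]
      simp
    obtain ⟨w, hw⟩ := cauchySeq_tendsto_of_complete hc
    refine ⟨hM.enum w, fun ε hε => ?_⟩
    have hε2 : 0 < ε / 2 := ENNReal.half_pos hε.ne'
    obtain ⟨k1, hk1⟩ := EMetric.tendsto_atTop.1 hw (ε / 2) hε2
    obtain ⟨k2, hk2⟩ := ENNReal.exists_inv_two_pow_lt hε2.ne'
    let k := max k1 k2
    refine ⟨m k, fun i hi => ?_⟩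
    obtain ⟨z, hz, hvz⟩ := hM.exists_tuple
      ((hN k (m k) (hmN k) i ((hmN k).trans hi)).trans_le
        ((pow_le_pow_right_of_le_one' (by simp) (le_max_right k1 k2)).trans hk2.le)) (hv k)
    calc K.dK (x i) (hM.enum w) ≤ edist z w := hM.dK_le hz (hM.tupleEmbeds_enum w)
      _ ≤ edist z (v k) + edist (v k) w := edist_triangle _ _ _
      _ < ε / 2 + ε / 2 := by
          rw [edist_comm z]
          exact ENNReal.add_lt_add hvz (hk1 k (le_max_left _ _))
      _ = ε := ENNReal.add_halves ε

end IsExactLimit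

/-- A separable `K`-structure with the forth property for members of `K` is a limit. -/
theorem isExactLimit_of_hasForth (hK : ∀ A, K A → Finite A.carrier)
    (hsep : TopologicalSpace.SeparableSpace M.carrier) (hM : K.IsKStructure M)
    (h : ∀ A, K A → HasForth A M) : K.IsExactLimit M where
  separable := hsep
  isKStructure := hM
  extension B hB n a b hab := by
    have := hK B hB
    obtain ⟨f, hf, hfS⟩ := (h B hB).exists_embedding (Set.finite_range fun i => (a i, b i))
      (tupleEmbeds_iff.1 hab)
    exact ⟨f, hf, fun i => hfS _ ⟨i, rfl⟩⟩

/-- A universal ultrahomogeneous separable `K`-structure is a limit. -/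
theorem isExactLimit_of_ultrahomogeneous
    (hsep : TopologicalSpace.SeparableSpace M.carrier) (hM : K.IsKStructure M)
    (huniv : ∀ B, K B → ∃ f, IsEmbedding B M f) (hu : M.Ultrahomogeneous) :
    K.IsExactLimit M where
  separable := hsep
  isKStructure := hM
  extension B hB n a b hab := by
    obtain ⟨f, hf⟩ := huniv B hB
    have hcb : TupleEmbeds (A := M) (B := M) (fun i => f (a i)) b :=
      (hf.tupleEmbeds a).symm.trans hab
    -- Several indices may give the same point; the choice is harmless, since `hcb` forces the
    -- corresponding entries of `b` to be equal.
    choose k hk using fun x : Set.range (fun i => f (a i)) => x.2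
    obtain ⟨g, hg, hgf⟩ := hu (Set.range fun i => f (a i)) (Set.finite_range _)
      (fun x => b (k x))
      (fun x y => by rw [hcb.1, hk, hk])
      (fun R e => (hcb.2 R (fun i => k (e i))).trans
        (congrArg _ (funext fun i => hk (e i))))
    refine ⟨g ∘ f, hg.1.comp hf, fun i => ?_⟩
    have h1 := hgf ⟨f (a i), i, rfl⟩
    refine h1.trans (dist_eq_zero.1 ?_)
    rw [hcb.1, hk, dist_self]

end StructClass

/-! ## The cone of cut functions -/

namespace CutCone

variable {ι : Type*} [DecidableEq ι]

/-- The cut function of `Q`: it is `1` on the sets that meet both `Q` and its complement. -/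
def cut (Q T : Finset ι) : ℝ := if ¬Disjoint T Q ∧ ¬T ⊆ Q then 1 else 0

theorem cut_empty_left (T : Finset ι) : cut ∅ T = 0 := by simp [cut]

theorem cut_empty_right (Q : Finset ι) : cut Q ∅ = 0 := by simp [cut]

variable [Fintype ι]

/-- The coefficient of the cut `S` in a combination of cut functions, by Möbius inversion. -/
def coeff (S : Finset ι) (Δ : Finset ι → ℝ) : ℝ :=
  -∑ S' ∈ S.powerset, (-1) ^ S'.card * Δ (Sᶜ ∪ S')

theorem cut_compl (Q : Finset ι) : cut Qᶜ = cut Q := by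
  funext T
  unfold cut
  have h1 : Disjoint T Qᶜ ↔ T ⊆ Q := by
    rw [disjoint_compl_right_iff]
  have h2 : T ⊆ Qᶜ ↔ Disjoint T Q := by
    exact le_compl_iff_disjoint_right
  simp only [h1, h2, and_comm]

/-- As `i₀` lies in `Sᶜ` and not in `Q`, the set `Sᶜ ∪ S'` is never inside `Q`; it is cut unless it
is disjoint from `Q`, that is, unless `Q ⊆ S` and `S' ⊆ S \ Q`. What remains are alternating sums
over the subsets of `S` and of `S \ Q`, which vanish unless the set is empty. -/
theorem coeff_cut {i₀ : ι} {S Q : Finset ι} (hS : i₀ ∉ S) (hQ : i₀ ∉ Q) (hne : S.Nonempty) :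
    coeff S (cut Q) = if Q = S then 1 else 0 := by
  have h1 : ∀ S' ∈ S.powerset, (-1 : ℝ) ^ S'.card * cut Q (Sᶜ ∪ S') =
      (-1) ^ S'.card - if Q ⊆ S ∧ S' ∈ (S \ Q).powerset then (-1) ^ S'.card else 0 := by
    intro S' hS'
    rw [Finset.mem_powerset] at hS'
    have h2 : ¬Sᶜ ∪ S' ⊆ Q := fun h => hQ (h (by simp [hS]))
    have h3 : Disjoint (Sᶜ ∪ S') Q ↔ Q ⊆ S ∧ S' ∈ (S \ Q).powerset := by
      rw [Finset.disjoint_union_left, Finset.mem_powerset, Finset.subset_sdiff, disjoint_comm,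
        disjoint_compl_right_iff]
      tauto
    unfold cut
    by_cases h : Q ⊆ S ∧ S' ∈ (S \ Q).powerset <;> simp only [h3, h, h2] <;> simp
  unfold coeff
  rw [Finset.sum_congr rfl h1, Finset.sum_sub_distrib]
  have h4 : ∀ T : Finset ι, ∑ S' ∈ T.powerset, (-1 : ℝ) ^ S'.card = if T = ∅ then 1 else 0 := by
    intro T
    exact_mod_cast Finset.sum_powerset_neg_one_pow_card (x := T)
  rw [h4, if_neg hne.ne_empty]
  by_cases hQS : Q ⊆ S
  · have h5 : S.powerset.filter (fun S' => S' ∈ (S \ Q).powerset) = (S \ Q).powerset := by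
      ext S'
      simp only [Finset.mem_filter, Finset.mem_powerset]
      exact ⟨fun h => h.2, fun h => ⟨h.trans Finset.sdiff_subset, h⟩⟩
    simp only [hQS, true_and]
    rw [← Finset.sum_filter, h5, h4, zero_sub, neg_neg]
    refine if_congr ?_ rfl rfl
    rw [Finset.sdiff_eq_empty_iff_subset]
    exact ⟨fun h => hQS.antisymm h, fun h => h ▸ subset_rfl⟩
  · have : Q ≠ S := fun h => hQS (h ▸ subset_rfl)
    simp [hQS, this]

/-- The cuts of `ι` that are not trivial, each represented by its side that avoids `i₀`. -/
def sides (i₀ : ι) : Finset (Finset ι) := Finset.univ.filter fun S => i₀ ∉ S ∧ S.Nonempty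

theorem mem_sides {i₀ : ι} {S : Finset ι} : S ∈ sides i₀ ↔ i₀ ∉ S ∧ S.Nonempty := by
  simp [sides]

/-- Nonnegative combinations of cut functions. -/
structure IsCutCone (i₀ : ι) (Δ : Finset ι → ℝ) : Prop where
  nonneg : ∀ S ∈ sides i₀, 0 ≤ coeff S Δ
  expand : ∀ T, Δ T = ∑ S ∈ sides i₀, coeff S Δ * cut S T

theorem isCutCone_cut (i₀ : ι) (Q : Finset ι) : IsCutCone i₀ (cut Q) := by
  -- A set and its complement define the same cut, so `Q` may be taken on the side that avoids `i₀`.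
  wlog hQ : i₀ ∉ Q generalizing Q
  · rw [← cut_compl]
    exact this Qᶜ (by simpa using hQ)
  constructor
  · intro S hS
    rw [mem_sides] at hS
    rw [coeff_cut hS.1 hQ hS.2]
    split_ifs <;> norm_num
  · intro T
    have : ∀ S ∈ sides i₀, coeff S (cut Q) * cut S T = if Q = S then cut Q T else 0 := by
      intro S hS
      rw [mem_sides] at hS
      rw [coeff_cut hS.1 hQ hS.2]
      split_ifs with h
      · rw [h, one_mul]
      · rw [zero_mul]
    rw [Finset.sum_congr rfl this, Finset.sum_ite_eq]
    split_ifs with h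
    · rfl
    · have : Q = ∅ := by
        by_contra hne
        exact h (mem_sides.2 ⟨hQ, Finset.nonempty_iff_ne_empty.2 hne⟩)
      rw [this, cut_empty_left]

section Integral

variable {Ω : Type*} [MeasurableSpace Ω] {μ : Measure Ω} {Δ : Ω → Finset ι → ℝ}

theorem integrable_coeff (hΔ : ∀ T, Integrable (fun ω => Δ ω T) μ) (S : Finset ι) :
    Integrable (fun ω => coeff S (Δ ω)) μ :=
  (integrable_finsetSum _ fun _ _ => (hΔ _).const_mul _).neg

theorem coeff_integral (hΔ : ∀ T, Integrable (fun ω => Δ ω T) μ) (S : Finset ι) :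
    coeff S (fun T => ∫ ω, Δ ω T ∂μ) = ∫ ω, coeff S (Δ ω) ∂μ := by
  unfold coeff
  rw [integral_neg, integral_finsetSum _ fun _ _ => (hΔ _).const_mul _]
  simp only [integral_const_mul]

/-- The coefficients are fixed linear functionals, so they commute with the integral; no measurable
choice of a decomposition is needed. -/
theorem isCutCone_integral {i₀ : ι} (hΔ : ∀ T, Integrable (fun ω => Δ ω T) μ)
    (h : ∀ ω, IsCutCone i₀ (Δ ω)) : IsCutCone i₀ (fun T => ∫ ω, Δ ω T ∂μ) := by
  constructor
  · intro S hS
    rw [coeff_integral hΔ]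
    exact integral_nonneg fun ω => (h ω).nonneg S hS
  · intro T
    simp only [coeff_integral hΔ]
    calc ∫ ω, Δ ω T ∂μ = ∫ ω, ∑ S ∈ sides i₀, coeff S (Δ ω) * cut S T ∂μ :=
          integral_congr_ae (.of_forall fun ω => (h ω).expand T)
      _ = _ := by
          rw [integral_finsetSum _ fun S _ => (integrable_coeff hΔ S).mul_const _]
          simp only [integral_mul_const]

end Integral

/-- The difference of the largest and the smallest value of `f` on `T`. -/
noncomputable def spread {ι : Type*} (f : ι → ℝ) (T : Finset ι) : ℝ :=
  if h : T.Nonempty then T.sup' h f - T.inf' h f else 0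

theorem cut_lt_eq_indicator (f : ι → ℝ) {T : Finset ι} (hT : T.Nonempty) (t : ℝ) :
    cut (Finset.univ.filter fun i => t < f i) T =
      (Set.Ico (T.inf' hT f) (T.sup' hT f)).indicator (fun _ => 1) t := by
  have : (¬Disjoint T (Finset.univ.filter fun i => t < f i) ∧
      ¬T ⊆ Finset.univ.filter fun i => t < f i) ↔ t ∈ Set.Ico (T.inf' hT f) (T.sup' hT f) := by
    rw [Set.mem_Ico, Finset.inf'_le_iff, Finset.lt_sup'_iff, Finset.not_disjoint_iff,
      Finset.not_subset, and_comm]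
    simp
  by_cases h : t ∈ Set.Ico (T.inf' hT f) (T.sup' hT f)
  · rw [Set.indicator_of_mem h, cut, if_pos (this.2 h)]
  · rw [Set.indicator_of_notMem h, cut, if_neg (mt this.1 h)]

theorem integrable_cut_lt (f : ι → ℝ) (T : Finset ι) :
    Integrable fun t : ℝ => cut (Finset.univ.filter fun i => t < f i) T := by
  rcases T.eq_empty_or_nonempty with rfl | hT
  · simp [cut_empty_right]
  · simp only [cut_lt_eq_indicator f hT]
    exact (integrable_indicator_iff measurableSet_Ico).2 (integrableOn_const (by simp))

theorem integral_cut_lt (f : ι → ℝ) (T : Finset ι) :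
    ∫ t : ℝ, cut (Finset.univ.filter fun i => t < f i) T = spread f T := by
  rcases T.eq_empty_or_nonempty with rfl | hT
  · simp [cut_empty_right, spread]
  · simp only [cut_lt_eq_indicator f hT, spread, hT, dif_pos]
    rw [integral_indicator_const _ measurableSet_Ico]
    simp only [Measure.real, Real.volume_Ico, smul_eq_mul, mul_one]
    obtain ⟨i, hi⟩ := hT
    exact ENNReal.toReal_ofReal (sub_nonneg.2 ((Finset.inf'_le f hi).trans (Finset.le_sup' f hi)))

/-- Layer cake: the superlevel set `{t < f}` cuts `T` exactly when `t` lies between the minimum and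
the maximum of `f` on `T`, so the spread is an integral of cut functions. -/
theorem isCutCone_spread (i₀ : ι) (f : ι → ℝ) : IsCutCone i₀ (spread f) := by
  have h : spread f = fun T => ∫ t : ℝ, cut (Finset.univ.filter fun i => t < f i) T :=
    funext fun T => (integral_cut_lt f T).symm
  rw [h]
  exact isCutCone_integral (integrable_cut_lt f) fun t => isCutCone_cut i₀ _

/-- The sum of the coefficients of the two extensions of a cut to `j` only depends on the sets
that avoid `j`. -/
theorem coeff_add_coeff_insert {j : ι} {S : Finset ι} (hS : j ∉ S) {Δ Δ' : Finset ι → ℝ}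
    (h : ∀ T, j ∉ T → Δ T = Δ' T) :
    coeff S Δ + coeff (insert j S) Δ = coeff S Δ' + coeff (insert j S) Δ' := by
  have key : ∀ E : Finset ι → ℝ, coeff S E + coeff (insert j S) E =
      -∑ S' ∈ S.powerset, (-1) ^ S'.card * E ((insert j S)ᶜ ∪ S') := by
    intro E
    unfold coeff
    rw [Finset.sum_powerset_insert hS]
    -- The subsets of `insert j S` that contain `j` contribute the terms of `coeff S E` with
    -- opposite sign and cancel them. The surviving arguments of `E` all avoid `j`.
    have : ∑ S' ∈ S.powerset, (-1 : ℝ) ^ (insert j S').card * E ((insert j S)ᶜ ∪ insert j S') =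
        -∑ S' ∈ S.powerset, (-1 : ℝ) ^ S'.card * E (Sᶜ ∪ S') := by
      rw [← Finset.sum_neg_distrib]
      refine Finset.sum_congr rfl fun S' hS' => ?_
      have hj : j ∉ S' := fun hj => hS (Finset.mem_powerset.1 hS' hj)
      rw [Finset.card_insert_of_notMem hj]
      have : (insert j S)ᶜ ∪ insert j S' = Sᶜ ∪ S' := by
        ext i
        by_cases hi : i = j
        · subst hi; simp [hS]
        · simp [hi]
      rw [this]
      ring
    rw [this]
    ring
  rw [key, key]
  congr 1
  refine Finset.sum_congr rfl fun S' hS' => ?_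
  rw [h]
  have hj : j ∉ S' := fun hj => hS (Finset.mem_powerset.1 hS' hj)
  simp [hj]

theorem abs_coeff_sub_le {S : Finset ι} {Δ Δ' : Finset ι → ℝ} {r : ℝ}
    (h : ∀ T, |Δ T - Δ' T| ≤ r) : |coeff S Δ - coeff S Δ'| ≤ 2 ^ S.card * r := by
  have : coeff S Δ - coeff S Δ' =
      ∑ S' ∈ S.powerset, (-1) ^ S'.card * (Δ' (Sᶜ ∪ S') - Δ (Sᶜ ∪ S')) := by
    unfold coeff
    simp only [mul_sub, Finset.sum_sub_distrib]
    ring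
  rw [this]
  refine (Finset.abs_sum_le_sum_abs _ _).trans ?_
  refine (Finset.sum_le_card_nsmul _ _ r fun S' _ => ?_).trans_eq ?_
  · rw [abs_mul, abs_pow, abs_neg, abs_one, one_pow, one_mul, abs_sub_comm]
    exact h _
  · rw [Finset.card_powerset, nsmul_eq_mul]
    push_cast
    rfl

theorem IsCutCone.ext {i₀ : ι} {Δ Δ' : Finset ι → ℝ} (h : IsCutCone i₀ Δ) (h' : IsCutCone i₀ Δ')
    (hc : ∀ S ∈ sides i₀, coeff S Δ = coeff S Δ') : Δ = Δ' := by
  funext T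
  rw [h.expand, h'.expand]
  exact Finset.sum_congr rfl fun S hS => by rw [hc S hS]

end CutCone

/-! ## Spreads and `L₁` diversities -/

namespace CutCone

section Spread

variable {ι κ : Type*} (f : ι → ℝ)

theorem sub_le_spread {T : Finset ι} {i j : ι} (hi : i ∈ T) (hj : j ∈ T) :
    f i - f j ≤ spread f T := by
  rw [spread, dif_pos ⟨i, hi⟩]
  exact sub_le_sub (Finset.le_sup' f hi) (Finset.inf'_le f hj)

theorem spread_le {T : Finset ι} {r : ℝ} (hr : 0 ≤ r)
    (h : ∀ i ∈ T, ∀ j ∈ T, f i - f j ≤ r) : spread f T ≤ r := by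
  unfold spread
  split_ifs with hT
  · obtain ⟨i, hi, hi'⟩ := T.exists_mem_eq_sup' hT f
    obtain ⟨j, hj, hj'⟩ := T.exists_mem_eq_inf' hT f
    rw [hi', hj']
    exact h i hi j hj
  · exact hr

theorem spread_nonneg (T : Finset ι) : 0 ≤ spread f T := by
  rcases T.eq_empty_or_nonempty with rfl | ⟨i, hi⟩
  · simp [spread]
  · simpa using sub_le_spread f hi hi

theorem spread_eq_zero {T : Finset ι} (hT : T.card ≤ 1) : spread f T = 0 :=
  le_antisymm (spread_le f le_rfl fun i hi j hj => by
    rw [Finset.card_le_one.1 hT i hi j hj, sub_self]) (spread_nonneg f T)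

theorem spread_mono {S T : Finset ι} (h : S ⊆ T) : spread f S ≤ spread f T :=
  spread_le f (spread_nonneg f T) fun _ hi _ hj => sub_le_spread f (h hi) (h hj)

theorem spread_union_le [DecidableEq ι] (A B C : Finset ι) (hB : B.Nonempty) :
    spread f (A ∪ C) ≤ spread f (A ∪ B) + spread f (B ∪ C) := by
  have h1 := spread_nonneg f (A ∪ B)
  have h2 := spread_nonneg f (B ∪ C)
  obtain ⟨b, hb⟩ := hB
  have bA : b ∈ A ∪ B := Finset.mem_union_right _ hb
  have bC : b ∈ B ∪ C := Finset.mem_union_left _ hb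
  refine spread_le f (add_nonneg h1 h2) fun i hi j hj => ?_
  rcases Finset.mem_union.1 hi with hi | hi <;> rcases Finset.mem_union.1 hj with hj | hj
  · have := sub_le_spread f (Finset.mem_union_left B hi) (Finset.mem_union_left B hj)
    linarith
  · have := sub_le_spread f (Finset.mem_union_left B hi) bA
    have := sub_le_spread f bC (Finset.mem_union_right B hj)
    linarith
  · have := sub_le_spread f (Finset.mem_union_right B hi) bC
    have := sub_le_spread f bA (Finset.mem_union_left B hj)
    linarith
  · have := sub_le_spread f (Finset.mem_union_right B hi) (Finset.mem_union_right B hj)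
    linarith

theorem spread_pair [DecidableEq ι] (i j : ι) : spread f {i, j} = |f i - f j| := by
  refine le_antisymm (spread_le f (abs_nonneg _) ?_) (abs_le'.2 ⟨?_, ?_⟩)
  · intro k hk l hl
    have h1 := le_abs_self (f i - f j)
    have h2 := neg_abs_le (f i - f j)
    have h3 := abs_nonneg (f i - f j)
    rw [Finset.mem_insert, Finset.mem_singleton] at hk hl
    rcases hk with rfl | rfl <;> rcases hl with rfl | rfl <;> linarith
  · exact sub_le_spread f (by simp) (by simp)
  · rw [neg_sub]
    exact sub_le_spread f (by simp) (by simp)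

theorem spread_image [DecidableEq ι] (b : κ → ι) (T : Finset κ) :
    spread f (T.image b) = spread (fun k => f (b k)) T := by
  refine le_antisymm (spread_le f (spread_nonneg _ _) ?_) (spread_le _ (spread_nonneg _ _) ?_)
  · intro i hi j hj
    obtain ⟨k, hk, rfl⟩ := Finset.mem_image.1 hi
    obtain ⟨l, hl, rfl⟩ := Finset.mem_image.1 hj
    exact sub_le_spread (fun k => f (b k)) hk hl
  · exact fun k hk l hl =>
      sub_le_spread f (Finset.mem_image_of_mem b hk) (Finset.mem_image_of_mem b hl)

theorem integrable_spread {Ω : Type*} [MeasurableSpace Ω] {μ : Measure Ω} {g : ι → Ω → ℝ}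
    (hg : ∀ i, Integrable (g i) μ) (T : Finset ι) :
    Integrable (fun ω => spread (fun i => g i ω) T) μ := by
  rcases T.eq_empty_or_nonempty with rfl | hT
  · simp [spread]
  · have h1 : Integrable (T.sup' hT g) μ :=
      Finset.sup'_induction hT g (p := fun h => Integrable h μ) (fun _ ha _ hb => ha.sup hb) fun i _ => hg i
    have h2 : Integrable (T.inf' hT g) μ :=
      Finset.inf'_induction hT g (p := fun h => Integrable h μ) (fun _ ha _ hb => ha.inf hb) fun i _ => hg i
    refine (h1.sub h2).congr (.of_forall fun ω => ?_)
    simp [spread, hT]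

end Spread

end CutCone

/-! ### The diversity of `L₁(μ)` and of its subsets -/

namespace Diversity

open CutCone

section Lp

variable {Ω : Type u} [MeasurableSpace Ω] (μ : Measure Ω)

theorem l1δ_eq (F : Finset (Lp ℝ 1 μ)) :
    l1δ μ F = ∫ ω, spread (fun f : Lp ℝ 1 μ => (f : Ω → ℝ) ω) F ∂μ := by
  unfold l1δ spread
  split_ifs with h <;> simp

theorem integrable_spread_self (F : Finset (Lp ℝ 1 μ)) :
    Integrable (fun ω => spread (fun f : Lp ℝ 1 μ => (f : Ω → ℝ) ω) F) μ :=
  integrable_spread (fun f => L1.integrable_coeFn f) F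

theorem integrable_spread_coe {ι : Type*} (g : ι → Lp ℝ 1 μ) (T : Finset ι) :
    Integrable (fun ω => spread (fun i => (g i : Ω → ℝ) ω) T) μ :=
  integrable_spread (fun i => L1.integrable_coeFn (g i)) T

theorem l1δ_image [DecidableEq (Lp ℝ 1 μ)] {ι : Type*} (g : ι → Lp ℝ 1 μ) (T : Finset ι) :
    l1δ μ (T.image g) = ∫ ω, spread (fun i => (g i : Ω → ℝ) ω) T ∂μ := by
  simp only [l1δ_eq, spread_image]

theorem l1δ_pair [DecidableEq (Lp ℝ 1 μ)] (f g : Lp ℝ 1 μ) : l1δ μ {f, g} = dist f g := by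
  rw [l1δ_eq, dist_eq_norm, L1.norm_eq_integral_norm]
  refine integral_congr_ae ?_
  filter_upwards [Lp.coeFn_sub f g] with ω hω
  rw [spread_pair, hω, Pi.sub_apply, Real.norm_eq_abs]

/-- The diversity of `L₁(μ)`. -/
noncomputable def lp : Diversity (Lp ℝ 1 μ) where
  δ := l1δ μ
  nonneg F := by
    rw [l1δ_eq]
    exact integral_nonneg fun ω => spread_nonneg _ _
  eq_zero_iff F := by
    classical
    constructor
    · intro h
      refine Finset.card_le_one.2 fun f hf g hg => dist_eq_zero.1 (le_antisymm ?_ dist_nonneg)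
      rw [← l1δ_pair, ← h, l1δ_eq, l1δ_eq]
      refine integral_mono (integrable_spread_self μ _) (integrable_spread_self μ _)
        fun ω => spread_mono _ ?_
      intro x hx
      rcases Finset.mem_insert.1 hx with rfl | hx
      · exact hf
      · exact Finset.mem_singleton.1 hx ▸ hg
    · intro h
      rw [l1δ_eq]
      simp [spread_eq_zero _ h]
  triangle A B C hB := by
    classical
    rw [l1δ_eq, l1δ_eq, l1δ_eq, ← integral_add (integrable_spread_self μ _)
      (integrable_spread_self μ _)]
    refine integral_mono (integrable_spread_self μ _)
      ((integrable_spread_self μ _).add (integrable_spread_self μ _)) fun ω => ?_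
    exact @spread_union_le _ (fun f : Lp ℝ 1 μ => (f : Ω → ℝ) ω)
      (fun f g => Classical.propDecidable (f = g)) A B C hB

end Lp

open Classical in
/-- The diversity induced on `X` by an injective map into a diversity. -/
noncomputable def comap {X Y : Type u} (D : Diversity Y) (f : X → Y) (hf : Function.Injective f) :
    Diversity X where
  δ A := D.δ (A.image f)
  nonneg _ := D.nonneg _
  eq_zero_iff A := by rw [D.eq_zero_iff, Finset.card_image_of_injective _ hf]
  triangle A B C hB := by
    simp only [Finset.image_union]
    exact D.triangle _ _ _ (hB.image f)

theorem IsL1.of_isEmbedding {X Y : Type u} {D : Diversity X} {E : Diversity Y} (hE : E.IsL1)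
    {f : X → Y} (hf : IsEmbedding D E f) : D.IsL1 := by
  classical
  obtain ⟨Ω, mΩ, μ, φ, hφ⟩ := hE
  refine ⟨Ω, mΩ, μ, φ ∘ f, fun A => ?_⟩
  rw [← hf, ← hφ, Finset.image_image]

theorem comap_isEmbedding {X Y : Type u} (D : Diversity Y) (f : X → Y)
    (hf : Function.Injective f) : IsEmbedding (D.comap f hf) D f := by
  intro A
  simp only [comap]

open Classical in
theorem isL1_lp {Ω : Type u} [MeasurableSpace Ω] (μ : Measure Ω) : (lp μ).IsL1 :=
  ⟨Ω, _, μ, id, fun A => by rw [Finset.image_id]; rfl⟩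

open Classical in
/-- The values of an `L₁` diversity on a finite family of points lie in the cut cone. -/
theorem IsL1.isCutCone {X : Type u} {D : Diversity X} (hD : D.IsL1) {ι : Type*} [Fintype ι]
    [DecidableEq ι] (i₀ : ι) (b : ι → X) : IsCutCone i₀ fun T => D.δ (T.image b) := by
  obtain ⟨Ω, mΩ, μ, φ, hφ⟩ := hD
  have h : (fun T : Finset ι => D.δ (T.image b)) =
      fun T => ∫ ω, spread (fun i => (φ (b i) : Ω → ℝ) ω) T ∂μ := by
    funext T
    rw [← hφ, Finset.image_image, l1δ_image]
    rfl
  rw [h]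
  exact isCutCone_integral (integrable_spread_coe μ fun i => φ (b i)) fun ω => isCutCone_spread _ _

/-- The diversity of `L₁(μ)` on a subset. -/
noncomputable def ofLpSet {Ω : Type u} [MeasurableSpace Ω] (μ : Measure Ω)
    (s : Set (Lp ℝ 1 μ)) : Diversity s :=
  (lp μ).comap Subtype.val Subtype.val_injective

section OfLpSet

variable {Ω : Type u} [MeasurableSpace Ω] {μ : Measure Ω} (s : Set (Lp ℝ 1 μ))

theorem ofLpSet_image [DecidableEq s] {ι : Type*} (g : ι → s) (T : Finset ι) :
    (ofLpSet μ s).δ (T.image g) = ∫ ω, spread (fun i => ((g i : Lp ℝ 1 μ) : Ω → ℝ) ω) T ∂μ := by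
  classical
  simp only [ofLpSet, comap, Finset.image_image]
  convert l1δ_image μ (fun i => (g i : Lp ℝ 1 μ)) T using 1
  change l1δ μ _ = _
  congr!

theorem isL1_ofLpSet : (ofLpSet μ s).IsL1 := (isL1_lp μ).of_isEmbedding (comap_isEmbedding _ _ _)

open Classical in
-- The spread of a pair is `|f - g|`, so the induced metric is the norm distance, and completeness
-- and separability can be read off in `L₁`.
theorem metricSpace_ofLpSet : (ofLpSet μ s).metricSpace = (inferInstance : MetricSpace s) := by
  refine MetricSpace.ext ?_
  ext x y
  change (ofLpSet μ s).δ _ = dist (x : Lp ℝ 1 μ) y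
  simp only [ofLpSet, comap, Finset.image_insert, Finset.image_singleton]
  exact @l1δ_pair _ _ μ (fun f g => Classical.propDecidable (f = g)) x y

theorem isComplete_ofLpSet (hs : IsClosed s) : (ofLpSet μ s).IsComplete := by
  unfold IsComplete
  rw [metricSpace_ofLpSet]
  exact hs.completeSpace_coe

theorem isSeparable_ofLpSet (hs : TopologicalSpace.IsSeparable s) :
    (ofLpSet μ s).IsSeparable := by
  unfold IsSeparable
  rw [metricSpace_ofLpSet]
  exact hs.separableSpace

end OfLpSet

end Diversity

/-! ## Divisible measures -/

/-- A measure of infinite total mass for which every measurable set has measurable subsets of all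
smaller measures. -/
structure IsDivisible {Ω : Type*} [MeasurableSpace Ω] (μ : Measure Ω) : Prop where
  univ_eq_top : μ Set.univ = ∞
  exists_subset : ∀ s, MeasurableSet s → ∀ q : ℝ≥0, (q : ℝ≥0∞) ≤ μ s →
    ∃ t ⊆ s, MeasurableSet t ∧ μ t = q

/-- The measure of `s ∩ [-t, t]` is continuous in `t`, starts at zero and tends to the measure of
`s`, so the intermediate value theorem gives every smaller value. -/
theorem isDivisible_volume_real : IsDivisible (volume : Measure ℝ) where
  univ_eq_top := by simp
  exists_subset s hs q hq := by
    -- The full measure of `s` need not be attained at any finite `t`, so this case is treated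
    -- apart.
    rcases hq.eq_or_lt with hq | hq
    · exact ⟨s, subset_rfl, hs, hq.symm⟩
    let F : ℝ → ℝ := fun t => volume.real (s ∩ Set.Icc (-t) t)
    have hfin : ∀ t, volume (s ∩ Set.Icc (-t) t) ≠ ∞ := fun t =>
      (measure_mono Set.inter_subset_right).trans_lt (by simp [Real.volume_Icc]) |>.ne
    have hlip : ∀ a b, a ≤ b → F b ≤ F a + 2 * (b - a) := by
      intro a b hab
      have h1 : s ∩ Set.Icc (-b) b ⊆
          s ∩ Set.Icc (-a) a ∪ (Set.Icc (-b) (-a) ∪ Set.Icc a b) := by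
        rintro x ⟨hx, hx1, hx2⟩
        by_cases h1 : x < -a
        · exact .inr (.inl ⟨hx1, h1.le⟩)
        by_cases h2 : a < x
        · exact .inr (.inr ⟨h2.le, hx2⟩)
        · exact .inl ⟨hx, not_lt.1 h1, not_lt.1 h2⟩
      have h2 : F b ≤ _ := measureReal_mono h1 <| measure_union_ne_top (hfin a) <|
        measure_union_ne_top (by simp [Real.volume_Icc]) (by simp [Real.volume_Icc])
      refine h2.trans <| (measureReal_union_le _ _).trans <| add_le_add le_rfl <|
        (measureReal_union_le _ _).trans_eq ?_
      rw [Real.volume_real_Icc_of_le (by linarith), Real.volume_real_Icc_of_le hab]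
      ring
    have hmono : ∀ a b, a ≤ b → F a ≤ F b := fun a b hab =>
      measureReal_mono (Set.inter_subset_inter_right _
        (Set.Icc_subset_Icc (neg_le_neg hab) hab)) (hfin b)
    have hcont : Continuous F := by
      refine (LipschitzWith.of_le_add_mul 2 fun a b => ?_).continuous
      rcases le_total a b with hab | hab
      · have := hmono a b hab
        have := dist_nonneg (x := a) (y := b)
        simp only [NNReal.coe_ofNat]
        linarith
      · have := hlip b a hab
        rw [Real.dist_eq, abs_of_nonneg (sub_nonneg.2 hab)]
        exact this
    have h0 : F 0 = 0 := by
      have : s ∩ Set.Icc (-0) 0 ⊆ ({0} : Set ℝ) := by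
        rw [neg_zero, Set.Icc_self]
        exact Set.inter_subset_right
      have h1 : volume (s ∩ Set.Icc (-0) 0) = 0 := measure_mono_null this Real.volume_singleton
      exact (congrArg ENNReal.toReal h1).trans ENNReal.toReal_zero
    have hsup : ∃ n : ℕ, (q : ℝ≥0∞) < volume (s ∩ Set.Icc (-(n : ℝ)) n) := by
      have hU : s = ⋃ n : ℕ, s ∩ Set.Icc (-(n : ℝ)) n := by
        rw [← Set.inter_iUnion]
        refine (Set.inter_eq_left.2 fun x _ => ?_).symm
        obtain ⟨n, hn⟩ := exists_nat_ge |x|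
        exact Set.mem_iUnion.2 ⟨n, abs_le.1 hn⟩
      have hm : Monotone fun n : ℕ => s ∩ Set.Icc (-(n : ℝ)) n := fun m n hmn =>
        Set.inter_subset_inter_right _ <| Set.Icc_subset_Icc
          (neg_le_neg (by exact_mod_cast hmn)) (by exact_mod_cast hmn)
      rw [hU, hm.measure_iUnion] at hq
      exact lt_iSup_iff.1 hq
    obtain ⟨n, hn⟩ := hsup
    have hqn : (q : ℝ) ≤ F n := (ENNReal.ofReal_le_iff_le_toReal (hfin n)).1 <| by
      rw [ENNReal.ofReal_coe_nnreal]
      exact hn.le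
    obtain ⟨t, -, ht⟩ := intermediate_value_Icc (Nat.cast_nonneg n) hcont.continuousOn
      (show (q : ℝ) ∈ Set.Icc (F 0) (F n) from ⟨h0.trans_le q.2, hqn⟩)
    refine ⟨s ∩ Set.Icc (-t) t, Set.inter_subset_left, hs.inter measurableSet_Icc, ?_⟩
    rw [← ENNReal.ofReal_toReal (hfin t)]
    exact (congrArg ENNReal.ofReal ht).trans ENNReal.ofReal_coe_nnreal

/-- Over a one-point index type in the right universe, this is a copy of the line in `Type u`. -/
theorem isDivisible_volume_funUnique (α : Type*) [Unique α] :
    IsDivisible (volume : Measure (α → ℝ)) := by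
  have h := volume_preserving_funUnique α ℝ
  constructor
  · rw [← Set.preimage_univ (f := MeasurableEquiv.funUnique α ℝ),
      h.measure_preimage_equiv, isDivisible_volume_real.univ_eq_top]
  · intro s hs q hq
    have hs' : MeasurableSet ((MeasurableEquiv.funUnique α ℝ).symm ⁻¹' s) :=
      (MeasurableEquiv.funUnique α ℝ).symm.measurable hs
    have hss : MeasurableEquiv.funUnique α ℝ ⁻¹' ((MeasurableEquiv.funUnique α ℝ).symm ⁻¹' s) = s := by
      rw [← Set.preimage_comp, MeasurableEquiv.symm_comp_self, Set.preimage_id]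
    rw [← hss, h.measure_preimage_equiv] at hq
    obtain ⟨t, ht, htm, htq⟩ := isDivisible_volume_real.exists_subset _ hs' q hq
    refine ⟨MeasurableEquiv.funUnique α ℝ ⁻¹' t, ?_, (MeasurableEquiv.funUnique α ℝ).measurable htm,
      by rw [h.measure_preimage_equiv, htq]⟩
    exact (Set.preimage_mono ht).trans hss.subset

/-- The set `t` is chosen inside `w` or containing `w`, according to which measure is larger.
Nestedness makes the measure of the symmetric difference equal to the difference of the measures. -/
theorem IsDivisible.exists_symmDiff {Ω : Type*} [MeasurableSpace Ω] {μ : Measure Ω}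
    (hμ : IsDivisible μ) {s w : Set Ω} (hs : MeasurableSet s) (hw : MeasurableSet w) (hws : w ⊆ s)
    (hwf : μ w ≠ ∞) (q : ℝ≥0) (hq : (q : ℝ≥0∞) ≤ μ s) :
    ∃ t ⊆ s, MeasurableSet t ∧ μ t = q ∧ μ (symmDiff w t) = ENNReal.ofReal |μ.real w - q| := by
  have hwr : μ w = ENNReal.ofReal (μ.real w) := (ENNReal.ofReal_toReal hwf).symm
  have hqr : (q : ℝ≥0∞) = ENNReal.ofReal q := ENNReal.ofReal_coe_nnreal.symm
  rcases le_total (q : ℝ≥0∞) (μ w) with h | h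
  · obtain ⟨t, htw, ht, htq⟩ := hμ.exists_subset w hw q h
    refine ⟨t, htw.trans hws, ht, htq, ?_⟩
    have hqw : (q : ℝ) ≤ μ.real w := (ENNReal.ofReal_le_ofReal_iff measureReal_nonneg).1
      (by rwa [← hwr, ← hqr])
    rw [symmDiff_of_ge htw, measure_sdiff htw ht.nullMeasurableSet (by simp [htq]), htq,
      abs_of_nonneg (sub_nonneg.2 hqw), ENNReal.ofReal_sub _ q.coe_nonneg, ← hwr]
    exact congrArg _ hqr
  · have hqw : μ.real w ≤ (q : ℝ) := (ENNReal.ofReal_le_ofReal_iff q.2).1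
      (by rw [← hwr]; exact h.trans_eq hqr)
    have hd : ((q - (μ w).toNNReal : ℝ≥0) : ℝ≥0∞) = q - μ w := by
      rw [ENNReal.coe_sub, ENNReal.coe_toNNReal hwf]
    obtain ⟨t, hts, ht, htq⟩ := hμ.exists_subset (s \ w) (hs.diff hw) (q - (μ w).toNNReal) (by
      rw [hd, measure_sdiff hws hw.nullMeasurableSet hwf]
      exact tsub_le_tsub_right hq _)
    have hdisj : Disjoint w t := (Set.disjoint_sdiff_right (s := w) (t := s)).mono_right hts
    refine ⟨w ∪ t, Set.union_subset hws (hts.trans Set.sdiff_subset), hw.union ht, ?_, ?_⟩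
    · rw [measure_union hdisj ht, htq, hd, add_tsub_cancel_of_le h]
    · have : symmDiff w (w ∪ t) = t := by
        rw [symmDiff_of_le Set.subset_union_left]
        exact Set.union_sdiff_cancel_left (Set.disjoint_iff.1 hdisj)
      rw [this, htq, hd, abs_sub_comm, abs_of_nonneg (sub_nonneg.2 hqw),
        ENNReal.ofReal_sub _ measureReal_nonneg, ← hwr]
      exact congrArg (· - μ w) hqr

/-! ## Families of sets of finite measure -/

namespace Diversity

open CutCone

variable {Ω : Type u} [MeasurableSpace Ω]

/-- The measurable sets of finite measure. -/
abbrev FinMeasSet (μ : Measure Ω) := {s : Set Ω // MeasurableSet s ∧ μ s ≠ ∞}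

variable {μ : Measure Ω}

/-- The indicator function of a set of finite measure. -/
noncomputable def FinMeasSet.toLp (s : FinMeasSet μ) : Lp ℝ 1 μ := indicatorConstLp 1 s.2.1 s.2.2 1

theorem FinMeasSet.dist_toLp (s t : FinMeasSet μ) :
    dist s.toLp t.toLp = μ.real (symmDiff s.1 t.1) := by
  unfold FinMeasSet.toLp
  rw [dist_indicatorConstLp_eq_norm, norm_indicatorConstLp one_ne_zero ENNReal.one_ne_top]
  simp

/-- The set of indicator functions in `L₁(μ)`. -/
def indicators (μ : Measure Ω) : Set (Lp ℝ 1 μ) := Set.range FinMeasSet.toLp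

theorem mem_indicators_of_ae {f : Lp ℝ 1 μ} (h : ∀ᵐ ω ∂μ, f ω = 0 ∨ f ω = 1) :
    f ∈ indicators μ := by
  have hm : MeasurableSet {ω | f ω = 1} := (Lp.stronglyMeasurable f).measurable (measurableSet_singleton 1)
  have hfin : μ {ω | f ω = 1} ≠ ∞ := by
    refine ne_top_of_le_ne_top ((L1.integrable_coeFn f).measure_norm_ge_lt_top one_pos).ne
      (measure_mono fun ω hω => ?_)
    simp only [Set.mem_ofPred_eq] at hω ⊢
    rw [hω, norm_one]
  refine ⟨⟨_, hm, hfin⟩, Lp.ext ?_⟩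
  filter_upwards [h, indicatorConstLp_coeFn (p := 1) (hs := hm) (hμs := hfin) (c := (1 : ℝ))]
    with ω h1 h2
  refine h2.trans ?_
  by_cases hω : f ω = 1
  · rw [Set.indicator_of_mem (by exact hω), hω]
  · rw [Set.indicator_of_notMem (by exact hω), h1.resolve_right hω]

theorem ae_of_mem_indicators {f : Lp ℝ 1 μ} (h : f ∈ indicators μ) :
    ∀ᵐ ω ∂μ, f ω = 0 ∨ f ω = 1 := by
  obtain ⟨s, rfl⟩ := h
  filter_upwards [indicatorConstLp_coeFn (p := 1) (hs := s.2.1) (hμs := s.2.2) (c := (1 : ℝ))]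
    with ω hω
  change s.toLp ω = _ at hω
  rw [hω]
  by_cases h : ω ∈ s.1 <;> simp [h]

/-- A convergent sequence in `L₁` has a subsequence converging almost everywhere, and limits of
values in `{0, 1}` stay there. This makes the diversity of sets complete. -/
theorem isClosed_indicators : IsClosed (indicators μ) := by
  refine isClosed_of_closure_subset fun f hf => ?_
  obtain ⟨g, hg, hgf⟩ := mem_closure_iff_seq_limit.1 hf
  obtain ⟨ns, -, hns⟩ := (tendstoInMeasure_of_tendsto_Lp hgf).exists_seq_tendsto_ae
  refine mem_indicators_of_ae ?_
  filter_upwards [hns, ae_all_iff.2 fun n => ae_of_mem_indicators (hg n)] with ω h1 h2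
  have hcl : IsClosed ({0, 1} : Set ℝ) := (Set.toFinite _).isClosed
  exact hcl.mem_of_tendsto h1 (.of_forall fun n => h2 (ns n))

variable {ι : Type*}

/-- The diversity function of `L₁(μ)` on subfamilies of a family of sets. -/
noncomputable def setδ (s : ι → FinMeasSet μ) (T : Finset ι) : ℝ :=
  ∫ ω, spread (fun i => (s i).toLp ω) T ∂μ

theorem setδ_congr {s t : ι → FinMeasSet μ} {T : Finset ι} (h : ∀ i ∈ T, s i = t i) :
    setδ s T = setδ t T := by
  unfold setδ
  congr 1
  funext ω
  refine le_antisymm (spread_le _ (spread_nonneg _ _) fun i hi j hj => ?_)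
    (spread_le _ (spread_nonneg _ _) fun i hi j hj => ?_)
  · rw [h i hi, h j hj]
    exact sub_le_spread (fun i => (t i).toLp ω) hi hj
  · rw [← h i hi, ← h j hj]
    exact sub_le_spread (fun i => (s i).toLp ω) hi hj

variable [Fintype ι]

open Classical in
/-- The indices of the sets which separate `ω` from the way the set of index `i₀` contains it. -/
noncomputable def pattern {Ω : Type*} (i₀ : ι) (s : ι → Set Ω) (ω : Ω) : Finset ι :=
  Finset.univ.filter fun i => ¬(ω ∈ s i ↔ ω ∈ s i₀)

theorem mem_pattern {Ω : Type*} {i₀ i : ι} {s : ι → Set Ω} {ω : Ω} :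
    i ∈ pattern i₀ s ω ↔ ¬(ω ∈ s i ↔ ω ∈ s i₀) := by
  simp [pattern]

theorem measurableSet_pattern (i₀ : ι) {s : ι → Set Ω} (hs : ∀ i, MeasurableSet (s i))
    (S : Finset ι) : MeasurableSet {ω | pattern i₀ s ω = S} := by
  have : {ω | pattern i₀ s ω = S} = ⋂ i, {ω | i ∈ pattern i₀ s ω ↔ i ∈ S} := by
    ext ω
    simp [Finset.ext_iff]
  rw [this]
  refine MeasurableSet.iInter fun i => ?_
  have h : MeasurableSet {ω | i ∈ pattern i₀ s ω} := by
    have : {ω | i ∈ pattern i₀ s ω} = {ω | ω ∈ s i ↔ ω ∈ s i₀}ᶜ := by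
      ext ω
      simp [mem_pattern]
    rw [this]
    exact (MeasurableSet.iff (hs i) (hs i₀)).compl
  exact h.iff (.const _)

theorem self_notMem_pattern {Ω : Type*} {i₀ : ι} {s : ι → Set Ω} {ω : Ω} : i₀ ∉ pattern i₀ s ω := by
  simp [mem_pattern]

variable [DecidableEq ι]

open Classical in
theorem spread_indicator {Ω : Type*} (i₀ : ι) (s : ι → Set Ω) (ω : Ω) (T : Finset ι) :
    spread (fun i => (s i).indicator (fun _ => (1 : ℝ)) ω) T = cut (pattern i₀ s ω) T := by
  have hle : ∀ i j, (s i).indicator (fun _ => (1 : ℝ)) ω - (s j).indicator (fun _ => (1 : ℝ)) ω ≤ 1 := by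
    intro i j
    by_cases hi : ω ∈ s i <;> by_cases hj : ω ∈ s j <;> simp [hi, hj]
  unfold cut
  split_ifs with h
  · obtain ⟨i, hi, hiP⟩ := Finset.not_disjoint_iff.1 h.1
    obtain ⟨j, hj, hjP⟩ := Finset.not_subset.1 h.2
    refine le_antisymm (spread_le _ zero_le_one fun i _ j _ => hle i j) ?_
    have h1 := sub_le_spread (fun i => (s i).indicator (fun _ => (1 : ℝ)) ω) hi hj
    have h2 := sub_le_spread (fun i => (s i).indicator (fun _ => (1 : ℝ)) ω) hj hi
    rw [mem_pattern] at hiP hjP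
    by_cases h3 : ω ∈ s i <;> by_cases h4 : ω ∈ s j
    · tauto
    · simpa [h3, h4] using h1
    · simpa [h3, h4] using h2
    · tauto
  · refine le_antisymm (spread_le _ le_rfl fun i hi j hj => ?_) (spread_nonneg _ _)
    have : ω ∈ s i ↔ ω ∈ s j := by
      by_contra hne
      refine h ⟨fun hd => ?_, fun hsub => ?_⟩
      · have h1 := Finset.disjoint_left.1 hd hi
        have h2 := Finset.disjoint_left.1 hd hj
        rw [mem_pattern] at h1 h2
        tauto
      · have h1 := hsub hi
        have h2 := hsub hj
        rw [mem_pattern] at h1 h2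
        tauto
    by_cases hi : ω ∈ s i
    · simp [hi, this.1 hi]
    · simp [hi, mt this.2 hi]

theorem ae_spread_toLp (i₀ : ι) (s : ι → FinMeasSet μ) :
    ∀ᵐ ω ∂μ, ∀ T : Finset ι, spread (fun i => (s i).toLp ω) T =
      cut (pattern i₀ (fun i => (s i).1) ω) T := by
  filter_upwards [ae_all_iff.2 fun i => indicatorConstLp_coeFn (p := 1) (hs := (s i).2.1)
    (hμs := (s i).2.2) (c := (1 : ℝ))] with ω hω T
  rw [← spread_indicator]
  congr 1
  exact funext hω

theorem integrable_cut_pattern (i₀ : ι) (s : ι → FinMeasSet μ) (T : Finset ι) :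
    Integrable (fun ω => cut (pattern i₀ (fun i => (s i).1) ω) T) μ :=
  (integrable_spread_coe μ (fun i => (s i).toLp) T).congr <|
    (ae_spread_toLp i₀ s).mono fun _ h => h T

theorem setδ_eq_integral_cut (i₀ : ι) (s : ι → FinMeasSet μ) :
    setδ s = fun T => ∫ ω, cut (pattern i₀ (fun i => (s i).1) ω) T ∂μ :=
  funext fun T => integral_congr_ae <| (ae_spread_toLp i₀ s).mono fun _ h => h T

theorem isCutCone_setδ (i₀ : ι) (s : ι → FinMeasSet μ) : IsCutCone i₀ (setδ s) := by
  rw [setδ_eq_integral_cut i₀]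
  exact isCutCone_integral (integrable_cut_pattern i₀ s) fun ω => isCutCone_cut _ _

/-- At almost every point the spread of the indicators is the cut function of the pattern of that
point, so integrating `coeff_cut` leaves the measure of the atom with pattern `S`. -/
theorem coeff_setδ {i₀ : ι} (s : ι → FinMeasSet μ) {S : Finset ι} (hS : S ∈ sides i₀) :
    coeff S (setδ s) = μ.real {ω | pattern i₀ (fun i => (s i).1) ω = S} := by
  rw [setδ_eq_integral_cut i₀, coeff_integral (integrable_cut_pattern i₀ s)]
  rw [mem_sides] at hS
  simp only [coeff_cut hS.1 self_notMem_pattern hS.2]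
  rw [← integral_indicator_one (measurableSet_pattern i₀ (fun i => (s i).2.1) S)]
  refine integral_congr_ae (.of_forall fun ω => ?_)
  by_cases h : pattern i₀ (fun i => (s i).1) ω = S <;> simp [Set.indicator, h]

/-- A nonempty pattern forces the point into `s i` or `s i₀` for some `i`. The atom of the empty
pattern is different: it contains the complement of the union of all the sets. -/
theorem measure_pattern_ne_top {i₀ : ι} (s : ι → FinMeasSet μ) {S : Finset ι} (hS : S ∈ sides i₀) :
    μ {ω | pattern i₀ (fun i => (s i).1) ω = S} ≠ ∞ := by
  obtain ⟨i, hi⟩ := (mem_sides.1 hS).2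
  refine ne_top_of_le_ne_top (measure_union_ne_top (s i).2.2 (s i₀).2.2) (measure_mono ?_)
  rintro ω rfl
  rw [mem_pattern] at hi
  change ω ∈ (s i).1 ∨ ω ∈ (s i₀).1
  tauto

/-- In a divisible measure space, any one of finitely many sets can be moved so that the diversity
function takes prescribed values, by no more than the change of the coefficients of cuts. -/
theorem exists_update_setδ (hμ : IsDivisible μ) {i₀ j : ι} (hj : i₀ ≠ j) (s : ι → FinMeasSet μ)
    {Δ : Finset ι → ℝ} (hΔ : IsCutCone i₀ Δ) (h : ∀ T, j ∉ T → setδ s T = Δ T) :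
    ∃ z : FinMeasSet μ, setδ (Function.update s j z) = Δ ∧
      dist (s j).toLp z.toLp ≤ ∑ S ∈ Finset.univ.filter (fun S : Finset ι => i₀ ∉ S ∧ j ∉ S),
        |coeff (insert j S) (setδ s) - coeff (insert j S) Δ| := by
  classical
  set I := Finset.univ.filter (fun S : Finset ι => i₀ ∉ S ∧ j ∉ S) with hI
  have memI : ∀ {S}, S ∈ I ↔ i₀ ∉ S ∧ j ∉ S := by simp [hI]
  set P : Ω → Finset ι := pattern i₀ (fun i => (s i).1) with hP
  have hPm : ∀ S, MeasurableSet {ω | P ω = S} := measurableSet_pattern i₀ fun i => (s i).2.1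
  have hP0 : ∀ ω, i₀ ∉ P ω := fun ω => self_notMem_pattern
  -- The atoms of the family without its member `j`: forgetting `j` merges the patterns `S` and
  -- `insert j S`.
  let α : Finset ι → Set Ω := fun S => {ω | P ω = S} ∪ {ω | P ω = insert j S}
  have hα : ∀ {S}, j ∉ S → ∀ {ω}, ω ∈ α S ↔ (P ω).erase j = S := by
    intro S hS ω
    constructor
    · rintro (h1 | h1)
      · change P ω = S at h1
        rw [h1, Finset.erase_eq_of_notMem hS]
      · change P ω = insert j S at h1
        rw [h1, Finset.erase_insert hS]
    · intro h1
      by_cases h2 : j ∈ P ω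
      · exact .inr (by rw [Set.mem_ofPred_eq, ← h1, Finset.insert_erase h2])
      · exact .inl (by rw [Set.mem_ofPred_eq, ← h1, Finset.erase_eq_of_notMem h2])
  have hins : ∀ {S}, S ∈ I → insert j S ∈ sides i₀ := fun {S} hS =>
    mem_sides.2 ⟨by simp [hj, (memI.1 hS).1], Finset.insert_nonempty _ _⟩
  have hq : ∀ S ∈ I, (((coeff (insert j S) Δ).toNNReal : ℝ≥0) : ℝ≥0∞) ≤ μ (α S) := by
    intro S hS
    have hdisj : Disjoint {ω | P ω = S} {ω | P ω = insert j S} := by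
      refine Set.disjoint_left.2 fun ω (h1 : P ω = S) (h2 : P ω = insert j S) => ?_
      exact (memI.1 hS).2 (h1 ▸ h2 ▸ Finset.mem_insert_self j S)
    rw [show μ (α S) = _ from measure_union hdisj (hPm _)]
    rcases S.eq_empty_or_nonempty with rfl | hne
    -- The atom outside all the sets has infinite measure, so any weight fits; this is where
    -- infinite total mass is used.
    · refine le_of_le_of_eq le_top ?_
      rw [eq_comm, ENNReal.add_eq_top]
      left
      have hc : (⋃ i, (s i).1)ᶜ ⊆ {ω | P ω = ∅} := by
        intro ω hω
        simp only [Set.mem_compl_iff, Set.mem_iUnion, not_exists] at hω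
        refine Finset.eq_empty_of_forall_notMem fun i hi => ?_
        rw [hP, mem_pattern] at hi
        exact hi (iff_of_false (hω i) (hω i₀))
      have hU : μ (⋃ i, (s i).1) ≠ ∞ :=
        ((measure_iUnion_fintype_le _ _).trans_lt
          (ENNReal.sum_lt_top.2 fun i _ => (s i).2.2.lt_top)).ne
      refine top_le_iff.1 (le_of_eq_of_le ?_ (measure_mono hc))
      rw [measure_compl (MeasurableSet.iUnion fun i => (s i).2.1) hU, hμ.univ_eq_top,
        ENNReal.top_sub hU]
    -- The measure of `α S` is the sum of two weights of `setδ s`, which equals the corresponding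
    -- sum for `Δ` and so is at least the weight prescribed for `insert j S`.
    · have hS' : S ∈ sides i₀ := mem_sides.2 ⟨(memI.1 hS).1, hne⟩
      rw [← ENNReal.ofReal_toReal (measure_pattern_ne_top s hS'),
        ← ENNReal.ofReal_toReal (measure_pattern_ne_top s (hins hS)),
        ← ENNReal.ofReal_add ENNReal.toReal_nonneg ENNReal.toReal_nonneg]
      change ENNReal.ofReal _ ≤ ENNReal.ofReal (μ.real _ + μ.real _)
      rw [← coeff_setδ s hS', ← coeff_setδ s (hins hS), coeff_add_coeff_insert (memI.1 hS).2 h]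
      exact ENNReal.ofReal_le_ofReal (le_add_of_nonneg_left (hΔ.nonneg S hS'))
  have hex : ∀ S ∈ I, ∃ t ⊆ α S, MeasurableSet t ∧ μ t = ((coeff (insert j S) Δ).toNNReal : ℝ≥0) ∧
      μ (symmDiff {ω | P ω = insert j S} t) =
        ENNReal.ofReal |coeff (insert j S) (setδ s) - coeff (insert j S) Δ| := by
    intro S hS
    obtain ⟨t, h1, h2, h3, h4⟩ := hμ.exists_symmDiff ((hPm S).union (hPm (insert j S))) (hPm _)
      Set.subset_union_right (measure_pattern_ne_top s (hins hS)) _ (hq S hS)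
    refine ⟨t, h1, h2, h3, h4.trans ?_⟩
    rw [coeff_setδ s (hins hS), Real.coe_toNNReal _ (hΔ.nonneg _ (hins hS))]
  choose! ζ hζα hζm hζμ hζd using hex
  let Z : Set Ω := ⋃ S ∈ I, ζ S
  have hZm : MeasurableSet Z := Finset.measurableSet_biUnion _ hζm
  have hZfin : μ Z ≠ ∞ := ((measure_biUnion_finset_le _ _).trans_lt
    (ENNReal.sum_lt_top.2 fun S hS => by rw [hζμ S hS]; exact ENNReal.coe_lt_top)).ne
  have hZ : ∀ ω, ω ∈ Z ↔ ω ∈ ζ ((P ω).erase j) := by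
    intro ω
    have hmem : (P ω).erase j ∈ I := memI.2 ⟨fun h => hP0 ω (Finset.mem_of_mem_erase h), by simp⟩
    constructor
    · intro hω
      obtain ⟨S, hS, hωS⟩ := Set.mem_iUnion₂.1 hω
      rw [(hα (memI.1 hS).2).1 (hζα S hS hωS)]
      exact hωS
    · exact fun hω => Set.mem_iUnion₂.2 ⟨_, hmem, hω⟩
  -- Patterns are relative to `s i₀`: the index `j` belongs to the new pattern exactly where `z` and
  -- `s i₀` disagree, and this is to happen exactly on `Z`.
  let z : FinMeasSet μ := ⟨symmDiff (s i₀).1 Z, (s i₀).2.1.symmDiff hZm,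
    measure_symmDiff_ne_top (s i₀).2.2 hZfin⟩
  have hz : ∀ ω, ω ∈ z.1 ↔ ¬(ω ∈ (s i₀).1 ↔ ω ∈ Z) := by
    intro ω
    change ω ∈ symmDiff (s i₀).1 Z ↔ _
    rw [Set.mem_symmDiff]
    tauto
  refine ⟨z, ?_, ?_⟩
  · have hoff : ∀ T, j ∉ T → setδ (Function.update s j z) T = Δ T := fun T hT => by
      rw [← h T hT]
      exact setδ_congr fun i hi =>
        Function.update_of_ne (fun hij : i = j => hT (hij ▸ hi)) _ _
    have hcoeff : ∀ S ∈ I, coeff (insert j S) (setδ (Function.update s j z)) =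
        coeff (insert j S) Δ := by
      intro S hS
      have hset : {ω | pattern i₀ (fun i => (Function.update s j z i).1) ω = insert j S} = ζ S := by
        ext ω
        have hp : ∀ i, i ∈ pattern i₀ (fun i => (Function.update s j z i).1) ω ↔
            if i = j then ω ∈ Z else i ∈ P ω := by
          intro i
          rw [mem_pattern, Function.update_of_ne hj]
          split_ifs with hij
          · subst hij
            rw [Function.update_self, hz]
            tauto
          · rw [Function.update_of_ne hij, hP, mem_pattern]
        constructor
        · intro hω
          change _ = _ at hω
          have h1 : ω ∈ Z := by
            have := (hp j).1 (hω ▸ Finset.mem_insert_self j S)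
            simpa using this
          have h2 : (P ω).erase j = S := by
            ext i
            have := hp i
            rw [hω, Finset.mem_insert] at this
            by_cases hij : i = j
            · subst hij
              simp [(memI.1 hS).2]
            · simp only [hij, false_or, if_false] at this
              simp [hij, this]
          rw [hZ, h2] at h1
          exact h1
        · intro hω
          have h2 := (hα (memI.1 hS).2).1 (hζα S hS hω)
          have h1 : ω ∈ Z := (hZ ω).2 (h2.symm ▸ hω)
          change _ = _
          ext i
          rw [hp i, ← h2]
          by_cases hij : i = j <;> simp [hij, h1]
      rw [coeff_setδ _ (hins hS), hset, Measure.real, hζμ S hS, ENNReal.coe_toReal,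
        Real.coe_toNNReal _ (hΔ.nonneg _ (hins hS))]
    -- Equality of all weights suffices. Those of cuts containing `j` are right by the choice of
    -- `ζ`; the others follow from the sums, which are determined by the sets avoiding `j`.
    refine (isCutCone_setδ i₀ _).ext hΔ fun S hS => ?_
    rw [mem_sides] at hS
    by_cases hjS : j ∈ S
    · rw [← Finset.insert_erase hjS]
      exact hcoeff _ (memI.2 ⟨fun h => hS.1 (Finset.mem_of_mem_erase h), by simp⟩)
    · have := coeff_add_coeff_insert hjS hoff
      rw [hcoeff S (memI.2 ⟨hS.1, hjS⟩)] at this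
      linarith
  · rw [FinMeasSet.dist_toLp]
    refine ENNReal.toReal_le_of_le_ofReal (Finset.sum_nonneg fun _ _ => abs_nonneg _) ?_
    rw [ENNReal.ofReal_sum_of_nonneg fun _ _ => abs_nonneg _]
    refine (measure_mono ?_).trans <| (measure_biUnion_finset_le I
      fun S => symmDiff {ω | P ω = insert j S} (ζ S)).trans_eq (Finset.sum_congr rfl hζd)
    -- A point where `s j` and `z` differ is one where exactly one of the old and the new piece of
    -- its atom contains it.
    intro ω hω
    have hmem : (P ω).erase j ∈ I := memI.2 ⟨fun h => hP0 ω (Finset.mem_of_mem_erase h), by simp⟩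
    refine Set.mem_iUnion₂.2 ⟨_, hmem, ?_⟩
    have h1 : P ω = insert j ((P ω).erase j) ↔ j ∈ P ω :=
      ⟨fun h => h ▸ Finset.mem_insert_self _ _, fun h => (Finset.insert_erase h).symm⟩
    have h2 : j ∈ P ω ↔ ¬(ω ∈ (s j).1 ↔ ω ∈ (s i₀).1) := mem_pattern
    rw [Set.mem_symmDiff] at hω ⊢
    rw [hz, hZ] at hω
    change (P ω = _ ∧ _) ∨ (_ ∧ ¬ P ω = _)
    rw [h1, h2]
    tauto

end Diversity

/-! ## Diversities as relational metric structures -/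

namespace Diversity

open RelStruct StructClass CutCone

theorem signature_arity_ne_zero (k : signature.Symb) : signature.arity k ≠ 0 := Nat.succ_ne_zero k

theorem δ_eq_zero {X : Type u} (D : Diversity X) {A : Finset X} (hA : A.card ≤ 1) : D.δ A = 0 :=
  (D.eq_zero_iff A).2 hA

open Classical in
theorem onTuple_comp {X Y : Type u} {D : Diversity X} {E : Diversity Y} {f : X → Y}
    (hf : IsEmbedding D E f) {n : ℕ} (a : Fin n → X) : E.onTuple (f ∘ a) = D.onTuple a := by
  unfold onTuple
  rw [← hf, Finset.image_image]

open Classical in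
theorem onTuple_pair {X : Type u} (D : Diversity X) (x y : X) : D.onTuple ![x, y] = D.δ {x, y} := by
  unfold onTuple
  congr 1
  ext z
  simp [Fin.exists_fin_two, eq_comm]

theorem isStructureOf_toStruct {X : Type u} (D : Diversity X) (hD : D.IsComplete) :
    IsStructureOf (D.toStruct hD) D :=
  ⟨fun x y => (D.onTuple_pair x y).symm, fun _ _ => rfl⟩

variable {A B : RelStruct.{u} signature} {D : Diversity A.carrier} {E : Diversity B.carrier}

theorem IsEmbedding.toRelStruct (hD : IsStructureOf A D) (hE : IsStructureOf B E)
    {f : A.carrier → B.carrier} (hf : IsEmbedding D E f) : RelStruct.IsEmbedding A B f := by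
  refine ⟨fun x y => ?_, fun R a => by rw [hD.2, hE.2, onTuple_comp hf]⟩
  rw [hD.1, hE.1, ← onTuple_comp hf]
  congr 1
  funext i
  fin_cases i <;> rfl

open Classical in
-- An enumeration of `T` turns `δ T` into the value of one predicate. Arities start at one, so the
-- empty set is treated apart.
theorem isPartialIso_iff (hD : IsStructureOf A D) (hE : IsStructureOf B E)
    {S : Set (A.carrier × B.carrier)} :
    IsPartialIso A B S ↔ ∀ T : Finset (A.carrier × B.carrier), ↑T ⊆ S →
      E.δ (T.image Prod.snd) = D.δ (T.image Prod.fst) := by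
  constructor
  · intro h T hT
    rcases T.eq_empty_or_nonempty with rfl | hne
    · rw [E.δ_eq_zero (by simp), D.δ_eq_zero (by simp)]
    obtain ⟨k, hk⟩ : ∃ k, T.card = k + 1 := Nat.exists_eq_succ_of_ne_zero hne.card_pos.ne'
    let e : Fin (signature.arity k) → A.carrier × B.carrier := fun i =>
      ((T.equivFinOfCardEq hk).symm i : A.carrier × B.carrier)
    have he : Finset.univ.image e = T := by
      ext p
      simp only [Finset.mem_image, Finset.mem_univ, true_and]
      exact ⟨fun ⟨i, hi⟩ => hi ▸ ((T.equivFinOfCardEq hk).symm i).2,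
        fun hp => ⟨T.equivFinOfCardEq hk ⟨p, hp⟩, by simp [e]⟩⟩
    have := ((hE.2 k _).symm.trans
      (h.2 k e fun i => hT ((T.equivFinOfCardEq hk).symm i).2)).trans (hD.2 k _)
    unfold onTuple at this
    rw [← he, Finset.image_image, Finset.image_image]
    exact this
  · intro h
    have key : ∀ {n : ℕ} (e : Fin n → A.carrier × B.carrier), (∀ i, e i ∈ S) →
        E.onTuple (fun i => (e i).2) = D.onTuple (fun i => (e i).1) := by
      intro n e he
      have := h (Finset.univ.image e) (by
        intro p hp
        obtain ⟨i, -, rfl⟩ := Finset.mem_image.1 (Finset.mem_coe.1 hp)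
        exact he i)
      rw [Finset.image_image, Finset.image_image] at this
      exact this
    refine ⟨fun p hp q hq => ?_, fun R e he => by rw [hD.2, hE.2, key e he]⟩
    have := key ![p, q] (by
      intro i
      fin_cases i
      · exact hp
      · exact hq)
    rw [hD.1, hE.1]
    convert this using 2 <;> funext i <;> fin_cases i <;> rfl

open Classical in
theorem isPartialIso_range_iff (hD : IsStructureOf A D) (hE : IsStructureOf B E) {ι : Type*}
    {a : ι → A.carrier} {b : ι → B.carrier} :
    IsPartialIso A B (Set.range fun i => (a i, b i)) ↔
      ∀ T : Finset ι, E.δ (T.image b) = D.δ (T.image a) := by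
  rw [isPartialIso_iff hD hE]
  constructor
  · intro h T
    have := h (T.image fun i => (a i, b i)) (by
      intro p hp
      obtain ⟨i, -, rfl⟩ := Finset.mem_image.1 (Finset.mem_coe.1 hp)
      exact ⟨i, rfl⟩)
    rw [Finset.image_image, Finset.image_image] at this
    exact this
  · intro h T hT
    obtain ⟨T', rfl⟩ := Finset.subset_set_image_iff.1 (by rwa [Set.image_univ])
      |>.imp fun T' h => h.2.symm
    rw [Finset.image_image, Finset.image_image]
    exact h T'

open Classical in
theorem tupleEmbeds_iff_δ (hD : IsStructureOf A D) (hE : IsStructureOf B E) {n : ℕ}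
    {a : Fin n → A.carrier} {b : Fin n → B.carrier} :
    TupleEmbeds a b ↔ ∀ T : Finset (Fin n), E.δ (T.image b) = D.δ (T.image a) :=
  tupleEmbeds_iff.trans (isPartialIso_range_iff hD hE)

theorem isEmbedding_of_relStruct (hD : IsStructureOf A D) (hE : IsStructureOf B E)
    {f : A.carrier → B.carrier} (hf : RelStruct.IsEmbedding A B f) : IsEmbedding D E f := by
  classical
  intro T
  have h := (isPartialIso_range_iff hD hE (a := id) (b := f)).1
    (hf.isPartialIso (by rintro _ ⟨x, rfl⟩; rfl)) T
  rw [Finset.image_id] at h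
  convert h

theorem mem_finiteL1_of_isEmbedding (hE : IsStructureOf B E) (hL1 : E.IsL1) [Finite A.carrier]
    {f : A.carrier → B.carrier} (hf : RelStruct.IsEmbedding A B f) : finiteL1 A := by
  have he := comap_isEmbedding E f hf.injective
  refine ⟨inferInstance, E.comap f hf.injective, ⟨fun x y => ?_, fun R a => ?_⟩, hL1.of_isEmbedding he⟩
  · rw [← hf.1, hE.1, ← onTuple_comp he]
    congr 1
    funext i
    fin_cases i <;> rfl
  · rw [← hf.2, hE.2, onTuple_comp he]

theorem isKStructure_of_isL1 (hE : IsStructureOf B E) (hL1 : E.IsL1) : finiteL1.IsKStructure B :=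
  fun _ _ ⟨_, hf⟩ => mem_finiteL1_of_isEmbedding hE hL1 hf

theorem finite_of_mem_finiteL1 (A : RelStruct.{u} signature) (hA : finiteL1 A) :
    Finite A.carrier := hA.1

theorem hp_finiteL1 : StructClass.HP finiteL1.{u} := fun _ hA =>
  let ⟨_, _, hD, hL1⟩ := hA
  isKStructure_of_isL1 hD hL1

open Classical in
theorem onTuple_sub_le_sum {X : Type u} (D : Diversity X) {n : ℕ} (a b : Fin n → X) :
    D.onTuple a - D.onTuple b ≤ ∑ i, D.δ {a i, b i} := by
  have h := D.replace_le a b Finset.univ ∅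
  rw [Finset.empty_union, Finset.empty_union] at h
  exact sub_le_iff_le_add'.2 h

theorem abs_onTuple_sub_le (hD : IsStructureOf A D) {n : ℕ} (a b : Fin n → A.carrier) {r : ℝ}
    (h : ∀ i, dist (a i) (b i) ≤ r) : |D.onTuple a - D.onTuple b| ≤ n * r := by
  classical
  have key : ∀ a b : Fin n → A.carrier, (∀ i, dist (a i) (b i) ≤ r) →
      D.onTuple a - D.onTuple b ≤ n * r := by
    intro a b h
    refine (D.onTuple_sub_le_sum a b).trans ?_
    refine (Finset.sum_le_card_nsmul _ _ r fun i _ => ?_).trans_eq (by simp)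
    rw [← onTuple_pair, ← hD.1]
    exact h i
  exact abs_sub_le_iff.2 ⟨key a b h, key b a fun i => by rw [dist_comm]; exact h i⟩

/-- Embeddings preserve predicates, so both values may be computed in a common member where the
entries are close; there an `n`-ary predicate changes by at most `n` times the largest distance. -/
theorem cp_finiteL1 : StructClass.CP finiteL1.{u} := by
  have key : ∀ {n : ℕ} {F : finiteL1.{u}.Enum n → ℝ}
      {G : ∀ C : RelStruct.{u} signature, (Fin n → C.carrier) → ℝ},
      (∀ (C : RelStruct.{u} signature) (x : finiteL1.{u}.Enum n) (a : Fin n → C.carrier),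
        TupleEmbeds (A := x.str) (B := C) x.tup a → F x = G C a) →
      (∀ C : RelStruct.{u} signature, finiteL1 C → ∀ (a b : Fin n → C.carrier) (r : ℝ),
        (∀ i, dist (a i) (b i) ≤ r) → |G C a - G C b| ≤ n * r) →
      finiteL1.{u}.ContinuousEnum F := by
    intro n F G hF hG x ε hε
    have hr : 0 < ε / (n + 1) := by positivity
    -- Dividing by `n + 1` keeps the bound strict and covers `n = 0`.
    refine ⟨ENNReal.ofReal (ε / (n + 1)), ENNReal.ofReal_pos.2 hr, fun y hy => ?_⟩
    simp only [dK, iInf_lt_iff] at hy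
    obtain ⟨C, hC, a, b, hxa, hyb, hab⟩ := hy
    rw [hF C x a hxa, hF C y b hyb]
    refine (hG C hC a b (ε / (n + 1)) fun i => ?_).trans_lt ?_
    · have := (le_iSup (fun i => edist (a i) (b i)) i).trans hab.le
      rwa [edist_dist, ENNReal.ofReal_le_ofReal_iff hr.le] at this
    · rw [mul_div_assoc', div_lt_iff₀ (by positivity)]
      nlinarith
  constructor
  · refine key (G := fun C a => dist (a 0) (a 1)) (fun C x a h => (h.1 0 1).symm) ?_
    intro C _ a b r h
    refine (dist_dist_dist_le (a 0) (a 1) (b 0) (b 1)).trans ?_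
    have := h 0
    have := h 1
    push_cast
    linarith
  · intro R
    refine key (G := fun C a => C.interp R a) (fun C x a h => (h.2 R id).symm) ?_
    rintro C ⟨-, D, hD, -⟩ a b r h
    simp only [hD.2]
    exact abs_onTuple_sub_le hD a b h

end Diversity

/-! ## The diversity of sets of finite measure -/

namespace Diversity

open RelStruct StructClass CutCone

variable {Ω : Type u} [MeasurableSpace Ω]

/-- The diversity of sets of finite measure. -/
noncomputable def setDiversity (μ : Measure Ω) : Diversity (indicators μ) :=
  ofLpSet μ (indicators μ)

theorem isComplete_setDiversity (μ : Measure Ω) : (setDiversity μ).IsComplete :=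
  isComplete_ofLpSet _ isClosed_indicators

theorem isL1_setDiversity (μ : Measure Ω) : (setDiversity μ).IsL1 := isL1_ofLpSet _

theorem isSeparable_setDiversity (μ : Measure Ω) [MeasureTheory.IsSeparable μ] :
    (setDiversity μ).IsSeparable :=
  have : Fact ((1 : ℝ≥0∞) ≠ ∞) := ⟨ENNReal.one_ne_top⟩
  isSeparable_ofLpSet _ (.of_separableSpace _)

/-- The diversity of sets of finite measure as a relational metric structure. -/
noncomputable def setStruct (μ : Measure Ω) : RelStruct.{u} signature :=
  (setDiversity μ).toStruct (isComplete_setDiversity μ)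

/-- The diversity function of `setStruct μ`. -/
noncomputable def setStructDiversity (μ : Measure Ω) : Diversity (setStruct μ).carrier :=
  setDiversity μ

theorem isStructureOf_setStruct (μ : Measure Ω) :
    IsStructureOf (setStruct μ) (setStructDiversity μ) :=
  isStructureOf_toStruct (setDiversity μ) (isComplete_setDiversity μ)

variable {μ : Measure Ω}

/-- A set of finite measure as a point of the structure of all of them. -/
noncomputable def FinMeasSet.pt (s : FinMeasSet μ) : (setStruct μ).carrier := ⟨s.toLp, s, rfl⟩

theorem FinMeasSet.exists_pt_eq (x : (setStruct μ).carrier) : ∃ s : FinMeasSet μ, s.pt = x := by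
  obtain ⟨_, s, rfl⟩ := x
  exact ⟨s, rfl⟩

theorem FinMeasSet.dist_pt (s t : FinMeasSet μ) : dist s.pt t.pt = dist s.toLp t.toLp := by
  have h := metricSpace_ofLpSet (μ := μ) (indicators μ)
  change @dist _ (ofLpSet μ (indicators μ)).metricSpace.toDist s.pt t.pt = _
  rw [h]
  rfl

open Classical in
theorem setStructDiversity_image_pt {ι : Type*} (s : ι → FinMeasSet μ) (T : Finset ι) :
    (setStructDiversity μ).δ (T.image fun i => (s i).pt) = setδ s T := by
  exact @ofLpSet_image _ _ μ (indicators μ) (fun a b => Classical.propDecidable (a = b)) _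
    (fun i => (s i).pt) T

/-- The one-point extension property of the structure of sets of finite measure. -/
theorem hasForth_setStruct (hμ : IsDivisible μ) {A : RelStruct.{u} signature} (hA : finiteL1 A) :
    HasForth A (setStruct μ) := by
  classical
  obtain ⟨-, D, hD, hL1⟩ := hA
  intro S hS hiso x
  have : Fintype S := hS.fintype
  let s₀ : FinMeasSet μ := ⟨∅, .empty, by simp⟩
  choose rep hrep using fun y : (setStruct μ).carrier => FinMeasSet.exists_pt_eq y
  let b : Option S → A.carrier := fun o => o.elim x fun p => p.1.1
  let s : Option S → FinMeasSet μ := fun o => o.elim s₀ fun p => rep p.1.2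
  suffices h : ∃ z : FinMeasSet μ, ∀ T : Finset (Option S),
      setδ (Function.update s none z) T = D.δ (T.image b) by
    obtain ⟨z, hz⟩ := h
    refine ⟨z.pt, ((isPartialIso_range_iff hD (isStructureOf_setStruct μ) (a := b)
      (b := fun i => (Function.update s none z i).pt)).2 fun T => ?_).mono ?_⟩
    · rw [← hz, ← setStructDiversity_image_pt]
    · rintro p (rfl | hp)
      · exact ⟨none, Prod.ext rfl (congrArg FinMeasSet.pt (Function.update_self ..))⟩
      · exact ⟨some ⟨p, hp⟩, Prod.ext rfl <| (congrArg FinMeasSet.pt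
          (Function.update_of_ne (Option.some_ne_none _) _ _)).trans (hrep p.2)⟩
  -- With no pair given there is no base index other than `none`, but then any point serves as the
  -- image.
  rcases S.eq_empty_or_nonempty with hemp | ⟨p₀, hp₀⟩
  · refine ⟨s₀, fun T => ?_⟩
    have hsub : Subsingleton (Option S) := ⟨fun o o' => by
      have : IsEmpty S := Set.isEmpty_coe_sort.2 hemp
      rw [Subsingleton.elim o o']⟩
    have hc : T.card ≤ 1 := Finset.card_le_one_of_subsingleton T
    rw [← setStructDiversity_image_pt, δ_eq_zero _ (Finset.card_image_le.trans hc),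
      δ_eq_zero _ (Finset.card_image_le.trans hc)]
  · have hagree : ∀ T : Finset (Option S), none ∉ T → setδ s T = D.δ (T.image b) := by
      intro T hT
      have := (isPartialIso_iff hD (isStructureOf_setStruct μ)).1 hiso
        (T.image fun o => (b o, (s o).pt)) (by
          intro q hq
          obtain ⟨o, ho, rfl⟩ := Finset.mem_image.1 (Finset.mem_coe.1 hq)
          cases o with
          | none => exact (hT ho).elim
          | some p =>
            have : (b (some p), (s (some p)).pt) = p.1 := Prod.ext rfl (hrep p.1.2)
            rw [this]
            exact p.2)
      rw [Finset.image_image, Finset.image_image] at this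
      rw [← setStructDiversity_image_pt]
      exact this
    obtain ⟨z, hz, -⟩ := exists_update_setδ hμ (Option.some_ne_none (⟨p₀, hp₀⟩ : S)) s
      (hL1.isCutCone _ b) hagree
    exact ⟨z, fun T => congrFun hz T⟩

theorem isExactLimit_setStruct (hμ : IsDivisible μ) [MeasureTheory.IsSeparable μ] :
    IsExactLimit finiteL1 (setStruct μ) :=
  isExactLimit_of_hasForth finite_of_mem_finiteL1 (isSeparable_setDiversity μ)
    (isKStructure_of_isL1 (isStructureOf_setStruct μ) (isL1_setDiversity μ))
    fun _ hA => hasForth_setStruct hμ hA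

open Classical in
theorem edist_δ_le_dInfty {A B : RelStruct.{u} signature} {D : Diversity A.carrier}
    {E : Diversity B.carrier} (hD : IsStructureOf A D) (hE : IsStructureOf B E) {n : ℕ}
    (a : Fin n → A.carrier) (b : Fin n → B.carrier) (T : Finset (Fin n)) :
    edist (D.δ (T.image a)) (E.δ (T.image b)) ≤ dInfty (A := A) (B := B) a b := by
  rcases T.eq_empty_or_nonempty with rfl | hT
  · rw [D.δ_eq_zero (by simp), E.δ_eq_zero (by simp), edist_self]
    exact bot_le
  obtain ⟨k, hk⟩ : ∃ k, T.card = k + 1 := Nat.exists_eq_succ_of_ne_zero hT.card_pos.ne'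
  let e : Fin (signature.arity k) ↪o Fin n := T.orderEmbOfFin hk
  have he : Finset.univ.image e = T := Finset.image_orderEmbOfFin_univ T hk
  have h1 : A.interp k (a ∘ e) = D.δ (T.image a) := by
    refine (hD.2 k _).trans ?_
    unfold onTuple
    rw [← Finset.image_image]
    exact congrArg (fun T' => D.δ (Finset.image a T')) he
  have h2 : B.interp k (b ∘ e) = E.δ (T.image b) := by
    refine (hE.2 k _).trans ?_
    unfold onTuple
    rw [← Finset.image_image]
    exact congrArg (fun T' => E.δ (Finset.image b T')) he
  rw [← h1, ← h2]
  exact le_max_of_le_right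
    (le_iSup₂ (f := fun (R : signature.Symb) (e : Fin (signature.arity R) ↪o Fin n) =>
      edist (A.interp R (a ∘ e)) (B.interp R (b ∘ e))) k e)

/-- Bounded amalgamation inside the structure of sets of finite measure. -/
theorem exists_close_extension (hμ : IsDivisible μ) {A B : RelStruct.{u} signature}
    (hB : finiteL1 B) {D : Diversity A.carrier} (hD : IsStructureOf A D) {n : ℕ}
    {x : Fin (n + 1) → A.carrier} {y : Fin (n + 1) → B.carrier}
    (hxy : TupleEmbeds (A := A) (B := B) (fun i : Fin n => x i.castSucc) (fun i => y i.castSucc))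
    {v : Fin (n + 1) → (setStruct μ).carrier} (hv : TupleEmbeds (A := A) (B := setStruct μ) x v) :
    ∃ z, TupleEmbeds (A := B) (B := setStruct μ) y (Function.update v (Fin.last n) z) ∧
      edist (v (Fin.last n)) z ≤ 2 ^ (2 * (n + 1)) * dInfty (A := A) (B := B) x y := by
  classical
  obtain ⟨-, E, hE, hL1⟩ := hB
  cases n with
  | zero =>
    -- Tuples of length one carry no information: all values of the diversity on them vanish, so the
    -- point need not move.
    refine ⟨v (Fin.last 0), (tupleEmbeds_iff_δ hE (isStructureOf_setStruct μ)).2 fun T => ?_, ?_⟩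
    · have hc : T.card ≤ 1 := T.card_le_univ.trans_eq (Fintype.card_fin 1)
      rw [δ_eq_zero _ (Finset.card_image_le.trans hc), δ_eq_zero _ (Finset.card_image_le.trans hc)]
    · rw [edist_self]
      exact bot_le
  | succ m =>
    choose s hs using fun i => FinMeasSet.exists_pt_eq (v i)
    obtain rfl : (fun i => (s i).pt) = v := funext hs
    have hsD : ∀ T, setδ s T = D.δ (T.image x) := fun T => by
      rw [← setStructDiversity_image_pt]
      exact (tupleEmbeds_iff_δ hD (isStructureOf_setStruct μ)).1 hv T
    have hagree : ∀ T : Finset (Fin (m + 1 + 1)), Fin.last (m + 1) ∉ T → setδ s T = E.δ (T.image y) := by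
      intro T hT
      obtain ⟨T', rfl⟩ : ∃ T' : Finset (Fin (m + 1)), T'.image Fin.castSucc = T := by
        refine ⟨Finset.univ.filter fun i => i.castSucc ∈ T, ?_⟩
        ext i
        simp only [Finset.mem_image, Finset.mem_filter, Finset.mem_univ, true_and]
        constructor
        · rintro ⟨k, hk, rfl⟩
          exact hk
        · intro hi
          have hne : i ≠ Fin.last (m + 1) := fun h => hT (h ▸ hi)
          exact ⟨i.castPred hne, by simpa using hi, by simp⟩
      rw [hsD, Finset.image_image, Finset.image_image]
      exact ((tupleEmbeds_iff_δ hD hE).1 hxy T').symm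
    obtain ⟨z, hz, hdist⟩ := exists_update_setδ hμ (i₀ := (0 : Fin (m + 1 + 1))) (j := Fin.last (m + 1))
      (Fin.last_pos.ne) s (hL1.isCutCone 0 y) hagree
    refine ⟨z.pt, (tupleEmbeds_iff_δ hE (isStructureOf_setStruct μ)).2 fun T => ?_, ?_⟩
    · rw [← congrFun hz T, ← setStructDiversity_image_pt]
      congr 2
      funext i
      by_cases hi : i = Fin.last (m + 1)
      · subst hi
        simp
      · simp [hi]
    · by_cases htop : dInfty (A := A) (B := B) x y = ∞
      · rw [htop, ENNReal.mul_top (by positivity)]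
        exact le_top
      set r := (dInfty (A := A) (B := B) x y).toReal with hr
      have hr0 : 0 ≤ r := ENNReal.toReal_nonneg
      have hrd : dInfty (A := A) (B := B) x y = ENNReal.ofReal r := (ENNReal.ofReal_toReal htop).symm
      have habs : ∀ T, |setδ s T - E.δ (T.image y)| ≤ r := by
        intro T
        have := edist_δ_le_dInfty hD hE x y T
        rw [hrd, edist_dist, ENNReal.ofReal_le_ofReal_iff hr0, Real.dist_eq, ← hsD] at this
        exact this
      have hsum : dist (s (Fin.last (m + 1))).pt z.pt ≤ 2 ^ (2 * (m + 1 + 1)) * r := by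
        rw [FinMeasSet.dist_pt]
        refine hdist.trans ?_
        -- One factor `2 ^ (m + 2)` bounds the number of terms in a weight; the second, below,
        -- bounds the number of cuts `S`.
        have hterm : ∀ S : Finset (Fin (m + 1 + 1)), |coeff S (setδ s) - coeff S fun T => E.δ (T.image y)| ≤
            2 ^ (m + 1 + 1) * r := fun S =>
          (abs_coeff_sub_le habs).trans <| mul_le_mul_of_nonneg_right
            (pow_le_pow_right₀ one_le_two (card_finset_fin_le S)) hr0
        refine (Finset.sum_le_card_nsmul _ _ _ fun S _ => hterm (insert _ S)).trans ?_
        rw [nsmul_eq_mul, two_mul (m + 1 + 1), pow_add _ (m + 1 + 1) (m + 1 + 1), mul_assoc]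
        have hr' : (0 : ℝ) ≤ 2 ^ (m + 1 + 1) * r := by positivity
        refine mul_le_mul_of_nonneg_right ?_ hr'
        have := Finset.card_le_univ
          (Finset.univ.filter fun S : Finset (Fin (m + 1 + 1)) => 0 ∉ S ∧ Fin.last (m + 1) ∉ S)
        rw [Fintype.card_finset, Fintype.card_fin] at this
        exact_mod_cast this
      rw [edist_dist, hrd]
      refine (ENNReal.ofReal_le_ofReal hsum).trans_eq ?_
      rw [ENNReal.ofReal_mul (by positivity), ENNReal.ofReal_pow (by norm_num)]
      simp

theorem bapWith_finiteL1 (hμ : IsDivisible μ) [MeasureTheory.IsSeparable μ] :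
    StructClass.BAPWith finiteL1.{u} fun n => 2 ^ (2 * n) := by
  intro n A B hA hB a w b z hab
  have hM := isExactLimit_setStruct hμ
  obtain ⟨f, hf⟩ := hM.exists_embedding_of_mem signature_arity_ne_zero hA
  obtain ⟨-, D, hD, -⟩ := id hA
  obtain ⟨z', hz', hd⟩ := exists_close_extension hμ hB hD
    (x := (Fin.snoc a w : Fin (n + 1) → A.carrier)) (y := (Fin.snoc b z : Fin (n + 1) → B.carrier))
    (by simpa only [Fin.snoc_castSucc] using hab) (hf.tupleEmbeds _)
  set v : Fin (n + 1) → (setStruct μ).carrier :=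
    fun i => f ((Fin.snoc a w : Fin (n + 1) → A.carrier) i) with hv
  have hfin : (insert z' (Set.range v)).Finite := (Set.finite_range v).insert _
  have hmem : ∀ i, v i ∈ insert z' (Set.range v) := fun i => .inr ⟨i, rfl⟩
  -- Passing to the ambient structure commutes with appending the last entry, so both embeddings can
  -- be checked there.
  have hval : ∀ (g : Fin n → ((setStruct μ).restrict _ hfin).carrier) t,
      (fun i => (setStruct μ).restrictVal _ hfin ((Fin.snoc g t :
        Fin (n + 1) → ((setStruct μ).restrict _ hfin).carrier) i)) =
      (Fin.snoc (fun i => (setStruct μ).restrictVal _ hfin (g i))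
        ((setStruct μ).restrictVal _ hfin t) : Fin (n + 1) → (setStruct μ).carrier) :=
    fun g t => Fin.comp_snoc _ g t
  have lift : ∀ {C : RelStruct.{u} signature} {c : Fin (n + 1) → C.carrier}
      {p : Fin (n + 1) → ((setStruct μ).restrict _ hfin).carrier},
      TupleEmbeds (A := C) (B := setStruct μ) c
        (fun i => (setStruct μ).restrictVal _ hfin (p i)) →
      TupleEmbeds (A := C) (B := (setStruct μ).restrict _ hfin) c p := fun h => ⟨h.1, h.2⟩
  refine ⟨(setStruct μ).restrict _ hfin, fun i => (setStruct μ).restrictMk hfin (hmem i.castSucc),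
    (setStruct μ).restrictMk hfin (hmem (Fin.last n)),
    (setStruct μ).restrictMk hfin (Set.mem_insert _ _), hM.isKStructure.restrict hfin,
    lift ?_, lift ?_, ?_⟩
  · rw [hval]
    have : (Fin.snoc (fun i : Fin n => v i.castSucc) (v (Fin.last n)) :
        Fin (n + 1) → (setStruct μ).carrier) = v := Fin.snoc_init_self v
    refine Eq.mp ?_ (hf.tupleEmbeds (Fin.snoc a w : Fin (n + 1) → A.carrier))
    exact congrArg _ this.symm
  · rw [hval]
    refine Eq.mp ?_ hz'
    refine congrArg _ ?_
    funext i
    refine Fin.lastCases ?_ (fun i => ?_) i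
    · rw [Fin.snoc_last, Function.update_self]
      rfl
    · rw [Fin.snoc_castSucc, Function.update_of_ne (Fin.castSucc_lt_last i).ne]
      rfl
  · refine le_trans hd (le_of_eq ?_)
    push_cast
    rfl

/-- An `L₁` diversity embeds into a complete one, separable if it is. -/
theorem IsL1.exists_completion {Y : Type u} {E : Diversity Y} (hE : E.IsL1) (hsep : E.IsSeparable) :
    ∃ (Z : Type u) (F : Diversity Z) (g : Y → Z),
      F.IsL1 ∧ F.IsComplete ∧ F.IsSeparable ∧ IsEmbedding E F g := by
  classical
  obtain ⟨Ω, mΩ, μ, φ, hφ⟩ := hE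
  let _ := E.metricSpace
  have hiso : Isometry φ := Isometry.of_dist_eq fun x y => by
    have := hφ {x, y}
    rw [Finset.image_insert, Finset.image_singleton] at this
    exact (l1δ_pair μ _ _).symm.trans this
  have : TopologicalSpace.SeparableSpace Y := hsep
  -- The completion is the closure of the image in `L₁`, which is again an `L₁` diversity.
  refine ⟨_, ofLpSet μ (closure (Set.range φ)), fun y => ⟨φ y, subset_closure ⟨y, rfl⟩⟩,
    isL1_ofLpSet _, isComplete_ofLpSet _ isClosed_closure,
    isSeparable_ofLpSet _ (TopologicalSpace.isSeparable_range hiso.continuous).closure, ?_⟩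
  intro A
  rw [ofLpSet_image, ← hφ, l1δ_image]

theorem isL1Universal_of_isExactLimit {X : Type u} {D : Diversity X} (hD : D.IsComplete)
    (hM : IsExactLimit finiteL1 (D.toStruct hD)) : D.IsL1Universal := by
  classical
  intro Y E hE hsep
  obtain ⟨Z, F, g, hF, hFc, hFs, hg⟩ := hE.exists_completion hsep
  have : TopologicalSpace.SeparableSpace (F.toStruct hFc).carrier := hFs
  obtain ⟨f, hf⟩ := hM.exists_embedding signature_arity_ne_zero
    (isKStructure_of_isL1 (isStructureOf_toStruct F hFc) hF)
  have hf' := isEmbedding_of_relStruct (isStructureOf_toStruct F hFc) (isStructureOf_toStruct D hD) hf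
  exact ⟨f ∘ g, fun A => (congrArg D.δ Finset.image_image.symm).trans ((hf' _).trans (hg A))⟩

theorem isExactLimit_toStruct {V : Type u} {E : Diversity V} (hE : E.IsComplete) (hL1 : E.IsL1)
    (hsep : E.IsSeparable) (hu : (E.toStruct hE).Ultrahomogeneous) (huniv : E.IsL1Universal) :
    IsExactLimit finiteL1 (E.toStruct hE) := by
  refine isExactLimit_of_ultrahomogeneous hsep
    (isKStructure_of_isL1 (isStructureOf_toStruct E hE) hL1) ?_ hu
  rintro B ⟨hfin, D, hD, hDL1⟩
  have hDsep : D.IsSeparable := by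
    let _ := D.metricSpace
    exact (inferInstance : TopologicalSpace.SeparableSpace B.carrier)
  obtain ⟨f, hf⟩ := huniv B.carrier D hDL1 hDsep
  exact ⟨f, hf.toRelStruct hD (isStructureOf_toStruct E hE)⟩

end Diversity

/-! ### The theorem, with Lebesgue measure -/

theorem mainTheorem4 :
    -- the class of finite diversities of `L₁` type has the five properties
    StructClass.HP Diversity.finiteL1.{u} ∧
    StructClass.JEP Diversity.finiteL1.{u} ∧
    StructClass.BAP Diversity.finiteL1.{u} ∧
    StructClass.PP Diversity.finiteL1.{u} ∧
    StructClass.CP Diversity.finiteL1.{u} ∧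
    -- the constant in the bounded amalgamation property for tuples of length `n` is `2 ^ (2 n)`
    StructClass.BAPWith Diversity.finiteL1.{u} (fun n => 2 ^ (2 * n)) ∧
    -- hence it is a Fraïssé class
    StructClass.IsFraisseClass Diversity.finiteL1.{u} ∧
    -- with a separable ultrahomogeneous limit, universal and unique
    ∃ (U : Type u) (D : Diversity U) (hD : D.IsComplete),
      D.IsL1 ∧ D.IsSeparable ∧
      StructClass.IsExactLimit Diversity.finiteL1.{u} (D.toStruct hD) ∧
      (D.toStruct hD).Ultrahomogeneous ∧
      D.IsL1Universal ∧
      (∀ (V : Type u) (E : Diversity V) (hE : E.IsComplete),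
        E.IsL1 → E.IsSeparable → (E.toStruct hE).Ultrahomogeneous → E.IsL1Universal →
          ∃ f : V → U, Diversity.IsEmbedding E D f ∧ Function.Bijective f) ∧
      (∀ N : RelStruct.{u} Diversity.signature,
        StructClass.IsExactLimit Diversity.finiteL1.{u} N →
          ∃ f, RelStruct.IsIsomorphism N (D.toStruct hD) f) := by
  -- Functions on a one-point type serve as the line, so that the limit lives in `Type u`.
  let μ : Measure (PUnit.{u + 1} → ℝ) := volume
  have hμ : IsDivisible μ := isDivisible_volume_funUnique _
  have hL := Diversity.signature_arity_ne_zero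
  have hfin := Diversity.finite_of_mem_finiteL1.{u}
  have hM := Diversity.isExactLimit_setStruct hμ
  have hbap := Diversity.bapWith_finiteL1 hμ
  have hjep := hM.jep hL hfin
  have hpp := hM.pp hL
  let x : (Diversity.setStruct μ).carrier :=
    Diversity.FinMeasSet.pt ⟨∅, .empty, by simp⟩
  have : Nonempty (Diversity.setStruct μ).carrier := ⟨x⟩
  -- A nonempty member of the class is needed for uniqueness: it makes every limit nonempty, as the
  -- back and forth requires.
  have hpt := hM.isKStructure.restrict (Set.finite_singleton x)
  let x' := (Diversity.setStruct μ).restrictMk (Set.finite_singleton x) rfl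
  refine ⟨Diversity.hp_finiteL1, hjep, ⟨_, hbap⟩, hpp, Diversity.cp_finiteL1, hbap,
    ⟨hfin, Diversity.hp_finiteL1, hjep, hM.ap hL hfin, hpp, Diversity.cp_finiteL1⟩,
    _, Diversity.setDiversity μ, Diversity.isComplete_setDiversity μ,
    Diversity.isL1_setDiversity μ, Diversity.isSeparable_setDiversity μ, hM, hM.ultrahomogeneous,
    Diversity.isL1Universal_of_isExactLimit _ hM, fun V E hE hL1 hsep hu huniv => ?_,
    fun N hN => hN.exists_isomorphism hL hpt x' hM⟩
  obtain ⟨f, hf, hsurj⟩ :=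
    (Diversity.isExactLimit_toStruct hE hL1 hsep hu huniv).exists_isomorphism hL hpt x' hM
  refine ⟨f, Diversity.isEmbedding_of_relStruct (Diversity.isStructureOf_toStruct E hE)
    (Diversity.isStructureOf_setStruct μ) hf, hf.injective, hsurj⟩
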